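/- For $m\ge 0$ let $\mathsf H_m=\sum_{j=1}^m\frac1j$. Generalized polylogarithms are defined recursively by $G(\,;z)=1$, $G(\underbrace{0,\dots,0}_{n};z)=\frac{\log^n z}{n!}$, and $$G(\alpha_1,\dots,\alpha_n;z)=\int_0^z\frac{\mathrm dx}{x-\alpha_1}\,G(\alpha_2,\dots,\alpha_n;x)\qquad\text{if }(\alpha_1,\dots,\alpha_n)\ne(0,\dots,0),$$ the integral being taken along the straight line segment from $0$ to $z$. For positive integers $a_j$ and nonzero complex numbers $z_j$, the multiple polylogarithm $\mathrm{Li}_{a_1,\dots,a_n}(z_1,\dots,z_n)$, i.e. the analytic continuation of $\sum_{\ell_1>\dots>\ell_n>0}\prod_{j=1}^n z_j^{\ell_j}/\ell_j^{a_j}$, is $$\mathrm{Li}_{a_1,\dots,a_n}(z_1,\dots,z_n)=(-1)^nG\Big(\underbrace{0,\dots,0}_{a_1-1},\tfrac1{z_1},\underbrace{0,\dots,0}_{a_2-1},\tfrac1{z_1z_2},\dots,\underbrace{0,\dots,0}_{a_n-1},\tfrac1{z_1\cdots z_n};1\Big);$$ thus $\mathrm{Li}_2(z)=-G(0,\frac1z;1)$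 and $\mathrm{Li}_{1,1}(z_1,z_2)=G(\frac1{z_1},\frac1{z_1z_2};1)$. Put $\theta=e^{\pi i/4}$, $\lambda=\log 2$, $\widetilde\lambda=\log(1+\sqrt2)$, $G=\operatorname{Im}\mathrm{Li}_2(i)$ (Catalan's constant), and $$L=L\Big(2,\Big(\frac{-8}{\cdot}\Big)\Big)=\sum_{n=1}^\infty\Big(\frac{-8}{n}\Big)\frac1{n^2},$$ where $\big(\frac{-8}{\cdot}\big)$ is the Kronecker symbol. Then all the series below converge, and $$\sum_{k=1}^\infty\frac{\binom{2k}k8^k}{(2k-1)\binom{3k}k\binom{6k}{3k}}=\frac{2\sqrt2\,\widetilde\lambda}{5}-\frac{\pi}{10\sqrt2},$$ $$\sum_{k=1}^\infty\frac{\big[-\mathsf H_k+2\mathsf H_{2k}+\mathsf H_{3k}-2\mathsf H_{6k}-\frac2{2k-1}\big]\binom{2k}k8^k}{(2k-1)\binom{3k}k\binom{6k}{3k}}=\frac{2\sqrt2\big[\operatorname{Re}\mathrm{Li}_{1,1}(i,\theta)+\operatorname{Im}\mathrm{Li}_2(\theta)-\frac G4\big]}5-\frac{3\lambda^2}{40\sqrt2}+\frac{\lambda\widetilde\lambda}{10\sqrt2}-\frac{\widetilde\lambda^2}{10\sqrt2}-\frac{83\pi^2}{480\sqrt2},$$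 $$\sum_{k=1}^\infty\frac{\big[\mathsf H_k-\mathsf H_{2k}+\frac2{2k-1}+2\log2\big]\binom{2k}k8^k}{(2k-1)\binom{3k}k\binom{6k}{3k}}=-\frac{\sqrt2\big[15\operatorname{Re}\mathrm{Li}_{1,1}(i,\theta)+\operatorname{Im}\mathrm{Li}_2(\theta)-\frac G4\big]}5+\frac{9\lambda^2}{16\sqrt2}+\frac{17\lambda\widetilde\lambda}{20\sqrt2}+\frac{3\widetilde\lambda^2}{4\sqrt2}-\frac{\pi\lambda}{20\sqrt2}-\frac{\pi^2}{320\sqrt2},$$ $$\sum_{k=1}^\infty\frac{\binom{2k}k8^k}{(2k-1)^2\binom{3k}k\binom{6k}{3k}}=\sqrt2\operatorname{Re}\mathrm{Li}_{1,1}(i,\theta)-\frac{3\lambda^2}{16\sqrt2}+\frac{\lambda\widetilde\lambda}{4\sqrt2}-\frac{\widetilde\lambda}{\sqrt2}-\frac{\widetilde\lambda^2}{4\sqrt2}+\frac{\pi}{4\sqrt2}+\frac{13\pi^2}{192\sqrt2}.$$ Consequently, $$\sum_{k=1}^\infty\frac{\big[(5k-1)(\mathsf H_{2k-1}-\mathsf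 H_{k-1})-\frac{3(6k-1)}{4(2k-1)}\big]\binom{2k}k8^k}{k(2k-1)\binom{3k}k\binom{6k}{3k}}=\frac{3\sqrt2\,\pi\log2}8-L,$$ $$\sum_{k=1}^\infty\frac{\big[(5k-1)(2\mathsf H_{6k-1}-\mathsf H_{3k-1}-\mathsf H_{k-1})-\frac{2(3k-1)}{2k-1}\big]\binom{2k}k8^k}{k(2k-1)\binom{3k}k\binom{6k}{3k}}=\frac{3\sqrt2\,\pi\log2}4,$$ $$\sum_{k=1}^\infty\frac{\big[(5k-1)(12\mathsf H_{6k-1}-6\mathsf H_{3k-1}-4\mathsf H_{2k-1}-2\mathsf H_{k-1})-9\big]\binom{2k}k8^k}{k(2k-1)\binom{3k}k\binom{6k}{3k}}=3\sqrt2\,\pi\log2+4L.$$ -/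

import Mathlib

noncomputable section

open scoped Nat

/-- Generalized polylogarithm `G(α₁, …, αₙ; z)`: it is `1` for the empty word, `logⁿ z / n!` for the
word of `n` zeros, and otherwise `∫₀^z dx / (x - α₁) · G(α₂, …, αₙ; x)` along the straight segment
from `0` to `z`, which is parametrized here by `x = t z` with `t ∈ [0, 1]`. -/
def GPL : List ℂ → ℂ → ℂ
  | [], _ => 1
  | a :: as, z =>
    open Classical in
    if ∀ α ∈ a :: as, α = 0 then
      Complex.log z ^ (as.length + 1) / ((as.length + 1)! : ℂ)
    else
      ∫ t in (0 : ℝ)..1, z / ((t : ℂ) * z - a) * GPL as ((t : ℂ) * z)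

/-- For `s = [(a₁, z₁), …, (aₙ, zₙ)]`, the word
`0^(a₁-1), 1/(p z₁), 0^(a₂-1), 1/(p z₁ z₂), …, 0^(aₙ-1), 1/(p z₁ ⋯ zₙ)`. -/
def mplWord : ℂ → List (ℕ+ × ℂ) → List ℂ
  | _, [] => []
  | p, (a, z) :: s => List.replicate ((a : ℕ) - 1) 0 ++ (p * z)⁻¹ :: mplWord (p * z) s

/-- Multiple polylogarithm `Li_{a₁, …, aₙ}(z₁, …, zₙ)` for `s = [(a₁, z₁), …, (aₙ, zₙ)]` with
nonzero `zⱼ`, as the analytic continuation of `∑_{ℓ₁ > ⋯ > ℓₙ > 0} ∏ⱼ zⱼ ^ ℓⱼ / ℓⱼ ^ aⱼ` given by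
`(-1)ⁿ G(0^(a₁-1), 1/z₁, 0^(a₂-1), 1/(z₁ z₂), …, 0^(aₙ-1), 1/(z₁ ⋯ zₙ); 1)`. -/
def MPL (s : List (ℕ+ × ℂ)) : ℂ :=
  (-1) ^ s.length * GPL (mplWord 1 s) 1

/-- `θ = e^{π i / 4}`. -/
def theta : ℂ := Complex.exp (Real.pi * Complex.I / 4)

/-- `Re Li_{1,1}(i, θ)`. -/
def reLi11 : ℝ := (MPL [(1, Complex.I), (1, theta)]).re

/-- `Im Li₂(θ)`. -/
def imLi2 : ℝ := (MPL [(2, theta)]).im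

/-- Catalan's constant `G = Im Li₂(i)`. -/
def catalanG : ℝ := (MPL [(2, Complex.I)]).im

/-- `L = L(2, (-8/·)) = ∑_{n ≥ 1} (-8/n) / n²`. The Kronecker symbol `(-8/·)` is the character
`ZMod.χ₈'` modulo `8` with value `1` at `1, 3`, value `-1` at `5, 7` and value `0` at even
numbers; the term with `n = 0` is zero. -/
def LConst : ℝ := ∑' n : ℕ, (ZMod.χ₈' (n : ZMod 8) : ℝ) / (n : ℝ) ^ 2

/-- The harmonic number `H_m = ∑_{j = 1}^m 1/j` as a real number. -/
def H (m : ℕ) : ℝ := (harmonic m : ℝ)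

/-- The factor `C(2k,k) 8^k / (C(3k,k) C(6k,3k))`. -/
def binomFactor (k : ℕ) : ℝ :=
  ((2 * k).choose k : ℝ) * 8 ^ k / (((3 * k).choose k : ℝ) * ((6 * k).choose (3 * k) : ℝ))

/-- The series `∑_{k = 1}^∞ f k` converges (absolutely) to `s`. -/
def HasSumFromOne (f : ℕ → ℝ) (s : ℝ) : Prop :=
  HasSum (fun n : ℕ => f (n + 1)) s

end

/-!
For `k ≥ 1`, `binomFactor k / (2k - 1)` is `2^{-k}` times the beta integral
`∫₀¹ y^{2(k-1)} (1 - y²)^{2k} dy`. Inserting `log y` or `log (1 - y²)` under the integral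
differentiates the beta function in one of its arguments, which is where the harmonic numbers come
from; here the derivatives are replaced by recurrences obtained from integration by parts. Summing
the geometric series gives the kernel `1 / ((2 - y²) (1 + y⁴))`, so by partial fractions every
series is a combination of integrals of `1`, `log y` and `log (1 - y²)` against `1 / (2 - y²)` and
`(1 ± y²) / (1 + y⁴)`.

The substitution `x = 2y / (1 + y²)` carries `dx / (2 - x²)` to `(1 - y²) / (1 + y⁴) dy`, and the
measure `(1 + y²) / (1 + y⁴) dy` becomes `dx / √2` on `[0, π/2]` under
`tan x = √2 y / (1 - y²)`; the integrals that remain are dilogarithms at `θ` and at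
`√2 - 1 = tan (π/8)`. The constant `Re Li_{1,1}(i, θ)` reduces to `Re Li₂(√2 - 1)` because
`z = (√2 - 1) θ` lies on the curve `z = (2 cos α - 1) e^{iα}`, along which `Re Li₂ z` is half of
`Re Li₂ (2 cos α - 1)` up to a polynomial in `α`. In the last three series the coefficients are
such that `Re Li₂(√2 - 1)` cancels.
-/

open intervalIntegral Set Filter Topology
open MeasureTheory (volume)
open scoped Nat Real

/-! ### Harmonic sums and beta moments -/

/-- The sum `1 + 1/3 + ⋯ + 1/(2N-1)`, in terms of which the logarithmic moments are expressed. -/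
noncomputable def oddHarmonic (N : ℕ) : ℝ := H (2 * N) - H N / 2

/-- The moments `∫₀¹ y^(2m) (1 - y²)^n h(y) dy`: for `h = 1` they are beta values, and for
logarithmic `h` they produce the harmonic numbers of the series. -/
noncomputable def betaMoment (h : ℝ → ℝ) (m n : ℕ) : ℝ :=
  ∫ y in (0 : ℝ)..1, y ^ (2 * m) * (1 - y ^ 2) ^ n * h y

theorem H_zero : H 0 = 0 := by simp [H]

theorem H_succ (n : ℕ) : H (n + 1) = H n + 1 / (n + 1) := by
  simp [H, harmonic_succ]

theorem H_sub_one {k : ℕ} (hk : 0 < k) : H (k - 1) = H k - 1 / k := by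
  obtain ⟨n, rfl⟩ := Nat.exists_eq_succ_of_ne_zero hk.ne'
  simp [H_succ]

theorem oddHarmonic_zero : oddHarmonic 0 = 0 := by simp [oddHarmonic, H_zero]

theorem oddHarmonic_succ (N : ℕ) : oddHarmonic (N + 1) = oddHarmonic N + 1 / (2 * N + 1) := by
  rw [oddHarmonic, oddHarmonic, show 2 * (N + 1) = 2 * N + 1 + 1 by ring, H_succ, H_succ, H_succ]
  push_cast
  field_simp
  ring

theorem betaMoment_succ_right {h : ℝ → ℝ} (hh : IntervalIntegrable h volume 0 1) (m n : ℕ) :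
    betaMoment h m (n + 1) = betaMoment h m n - betaMoment h (m + 1) n := by
  rw [betaMoment, betaMoment, betaMoment, ← integral_sub]
  · congr 1; ext y; ring
  · exact hh.continuousOn_mul (by fun_prop)
  · exact hh.continuousOn_mul (by fun_prop)

/-- Integration by parts; `g = y (1 - y²) h'` is polynomial in all the applications. -/
theorem betaMoment_add_betaMoment_eq {h g : ℝ → ℝ}
    (hc : ContinuousOn (fun y => y * (1 - y ^ 2) * h y) (Icc 0 1))
    (hd : ∀ y ∈ Ioo (0 : ℝ) 1, HasDerivAt h (g y / (y * (1 - y ^ 2))) y)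
    (hh : IntervalIntegrable h volume 0 1) (hg : IntervalIntegrable g volume 0 1) (m n : ℕ) :
    (2 * m + 1) * betaMoment h m (n + 1) + betaMoment g m n =
      2 * (n + 1) * betaMoment h (m + 1) n := by
  have hmoment {f : ℝ → ℝ} (hf : IntervalIntegrable f volume 0 1) (m n : ℕ) :
      IntervalIntegrable (fun y => y ^ (2 * m) * (1 - y ^ 2) ^ n * f y) volume 0 1 :=
    hf.continuousOn_mul (by fun_prop)
  have boundary := integral_eq_sub_of_hasDerivAt_of_le zero_le_one
    (f := fun y => y ^ (2 * m) * (1 - y ^ 2) ^ n * (y * (1 - y ^ 2) * h y))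
    (ContinuousOn.mul (by fun_prop) hc)
    (fun y hy => by
      have hy0 : y ≠ 0 := hy.1.ne'
      have hy1 : 1 - y ^ 2 ≠ 0 := by nlinarith [hy.1, hy.2]
      have hpow : HasDerivAt (fun y : ℝ => 1 - y ^ 2) (-(2 * y)) y := by
        simpa using (hasDerivAt_pow 2 y).const_sub 1
      refine ((((hasDerivAt_pow (2 * m + 1) y).mul (hpow.pow (n + 1))).mul (hd y hy))
        |>.congr_of_eventuallyEq (.of_forall fun y => ?_)).congr_deriv
        (g' := (2 * m + 1) * (y ^ (2 * m) * (1 - y ^ 2) ^ (n + 1) * h y) +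
          y ^ (2 * m) * (1 - y ^ 2) ^ n * g y -
          2 * (n + 1) * (y ^ (2 * (m + 1)) * (1 - y ^ 2) ^ n * h y)) ?_
      · simp only [Pi.mul_apply, Pi.pow_apply]
        ring
      · simp only [Pi.mul_apply, Pi.pow_apply, Nat.add_sub_cancel]
        push_cast
        field_simp
        ring)
    (((((hmoment hh m (n + 1)).const_mul _).add (hmoment hg m n)).sub
      ((hmoment hh (m + 1) n).const_mul _)))
  rw [integral_sub (((hmoment hh m (n + 1)).const_mul _).add (hmoment hg m n))
      ((hmoment hh (m + 1) n).const_mul _),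
    integral_add ((hmoment hh m (n + 1)).const_mul _) (hmoment hg m n),
    intervalIntegral.integral_const_mul, intervalIntegral.integral_const_mul] at boundary
  simp only [one_pow, sub_self, mul_zero, zero_mul] at boundary
  exact eq_of_sub_eq_zero boundary

theorem betaMoment_one_zero_right (m : ℕ) : betaMoment 1 m 0 = 1 / (2 * m + 1) := by
  simp [betaMoment]

theorem betaMoment_one_succ_left (m n : ℕ) :
    2 * (n + 1) * betaMoment 1 (m + 1) n = (2 * m + 1) * betaMoment 1 m (n + 1) := by
  have h := betaMoment_add_betaMoment_eq (h := 1) (g := 0) (by fun_prop)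
    (fun y _ => (hasDerivAt_const y (1 : ℝ)).congr_deriv (by simp)) intervalIntegrable_const
    intervalIntegrable_const m n
  simpa [betaMoment] using h.symm

theorem betaMoment_one_eq_mul_succ_right (m n : ℕ) :
    2 * (n + 1) * betaMoment 1 m n = (2 * m + 2 * n + 3) * betaMoment 1 m (n + 1) := by
  linear_combination betaMoment_one_succ_left m n -
    2 * (n + 1) * betaMoment_succ_right (h := 1) intervalIntegrable_const m n

theorem betaMoment_one (m n : ℕ) : betaMoment 1 m n =
    n ! * (2 * m)! * (m + n + 1)! * 2 ^ (2 * n + 1) / (m ! * (2 * m + 2 * n + 2)!) := by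
  induction n with
  | zero =>
    simp only [betaMoment_one_zero_right, Nat.factorial_succ, Nat.factorial_zero, add_zero,
      mul_zero]
    push_cast
    field_simp
    ring
  | succ n ih =>
    have h := betaMoment_one_eq_mul_succ_right m n
    rw [ih] at h
    refine mul_left_cancel₀ (by positivity : (2 * (m : ℝ) + 2 * n + 3) ≠ 0) (h.symm.trans ?_)
    simp only [show m + (n + 1) + 1 = m + n + 1 + 1 by ring,
      show 2 * m + 2 * (n + 1) + 2 = 2 * m + 2 * n + 2 + 1 + 1 by ring,
      show 2 * (n + 1) + 1 = 2 * n + 1 + 1 + 1 by ring, Nat.factorial_succ, pow_succ]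
    push_cast
    field_simp
    ring

theorem betaMoment_log_succ_left (m n : ℕ) : 2 * (n + 1) * betaMoment Real.log (m + 1) n =
    (2 * m + 1) * betaMoment Real.log m (n + 1) + betaMoment 1 m (n + 1) := by
  have h := betaMoment_add_betaMoment_eq (h := Real.log) (g := fun y => 1 - y ^ 2)
    ((Real.continuous_mul_log.mul (by fun_prop : Continuous fun y : ℝ => 1 - y ^ 2)).congr
      fun y => mul_right_comm _ _ _).continuousOn
    (fun y hy => (Real.hasDerivAt_log hy.1.ne').congr_deriv (by
      have : 1 - y ^ 2 ≠ 0 := by nlinarith [hy.1, hy.2]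
      field_simp))
    intervalIntegrable_log' (Continuous.intervalIntegrable (by fun_prop) _ _) m n
  rw [← h]
  simp [betaMoment, pow_succ, mul_assoc]

theorem betaMoment_log (m n : ℕ) : betaMoment Real.log m n =
    -(betaMoment 1 m n * (oddHarmonic (m + n + 1) - oddHarmonic m)) := by
  have split (m n : ℕ) := betaMoment_succ_right (h := Real.log) intervalIntegrable_log' m n
  induction n with
  | zero =>
    induction m with
    | zero => simp [betaMoment, oddHarmonic_succ, oddHarmonic_zero]
    | succ m ih =>
      have h := betaMoment_log_succ_left m 0
      rw [split, betaMoment_succ_right (h := 1) intervalIntegrable_const, ih] at h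
      simp only [betaMoment_one_zero_right, add_zero, oddHarmonic_succ] at h ⊢
      refine mul_left_cancel₀ (by positivity : (2 * (m : ℝ) + 3) ≠ 0) ?_
      push_cast at h ⊢
      linear_combination (norm := (field_simp; ring)) h
  | succ n ih =>
    rw [← add_assoc, oddHarmonic_succ]
    refine mul_left_cancel₀ (by positivity : (2 * (m : ℝ) + 2 * n + 3) ≠ 0) ?_
    push_cast
    linear_combination (norm := (field_simp; ring)) 2 * (n + 1) * split m n -
      betaMoment_log_succ_left m n + 2 * (n + 1) * ih -
      (oddHarmonic (m + n + 1) - oddHarmonic m) * betaMoment_one_eq_mul_succ_right m n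

theorem intervalIntegrable_log_one_sub_sq {a b : ℝ} :
    IntervalIntegrable (fun y : ℝ => Real.log (1 - y ^ 2)) volume a b :=
  MeromorphicOn.intervalIntegrable_log (f := fun y : ℝ => 1 - y ^ 2) fun y _ => by fun_prop

theorem integral_log_one_sub_sq :
    ∫ y in (0 : ℝ)..1, Real.log (1 - y ^ 2) = 2 * Real.log 2 - 2 := by
  have factor : ∫ y in (0 : ℝ)..1, Real.log (1 - y ^ 2) =
      ∫ y in (0 : ℝ)..1, (Real.log (1 - y) + Real.log (1 + y)) :=
    integral_congr_Ioo_of_le zero_le_one fun y hy => by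
      rw [← Real.log_mul (by linarith [hy.2]) (by linarith [hy.1])]
      ring_nf
  rw [factor, intervalIntegral.integral_add,
    integral_comp_sub_left (fun x => Real.log x), integral_comp_add_left (fun x => Real.log x)]
  · norm_num [integral_log]
  · exact MeromorphicOn.intervalIntegrable_log (f := fun y : ℝ => 1 - y) fun y _ => by fun_prop
  · exact MeromorphicOn.intervalIntegrable_log (f := fun y : ℝ => 1 + y) fun y _ => by fun_prop

theorem betaMoment_log_one_sub_sq_succ_left (m n : ℕ) :
    2 * (n + 1) * betaMoment (fun y => Real.log (1 - y ^ 2)) (m + 1) n =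
      (2 * m + 1) * betaMoment (fun y => Real.log (1 - y ^ 2)) m (n + 1) -
        2 * betaMoment 1 (m + 1) n := by
  have h := betaMoment_add_betaMoment_eq
    (h := fun y => Real.log (1 - y ^ 2)) (g := fun y => -2 * y ^ 2)
    ((continuous_id.mul (Real.continuous_mul_log.comp
      (by fun_prop : Continuous fun y : ℝ => 1 - y ^ 2))).congr
      fun y => (mul_assoc _ _ _).symm).continuousOn
    (fun y hy => by
      have : y ≠ 0 := hy.1.ne'
      have hy1 : 1 - y ^ 2 ≠ 0 := by nlinarith [hy.1, hy.2]
      refine (((hasDerivAt_pow 2 y).const_sub 1).log hy1).congr_deriv ?_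
      field_simp
      ring)
    intervalIntegrable_log_one_sub_sq (Continuous.intervalIntegrable (by fun_prop) _ _) m n
  have hg : betaMoment (fun y => -2 * y ^ 2) m n = -2 * betaMoment 1 (m + 1) n := by
    rw [betaMoment, betaMoment, ← intervalIntegral.integral_const_mul]
    congr 1; ext y; simp only [Pi.one_apply]; ring
  linear_combination -h + hg

theorem betaMoment_log_one_sub_sq (m n : ℕ) : betaMoment (fun y => Real.log (1 - y ^ 2)) m n =
    betaMoment 1 m n * (H n + 2 * Real.log 2 - 2 * oddHarmonic (m + n + 1)) := by
  have split (m n : ℕ) := betaMoment_succ_right intervalIntegrable_log_one_sub_sq m n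
  induction n with
  | zero =>
    induction m with
    | zero => simp [betaMoment, integral_log_one_sub_sq, oddHarmonic_succ, oddHarmonic_zero, H_zero]
    | succ m ih =>
      have h := betaMoment_log_one_sub_sq_succ_left m 0
      rw [split, ih] at h
      simp only [betaMoment_one_zero_right, add_zero, oddHarmonic_succ, H_zero] at h ⊢
      refine mul_left_cancel₀ (by positivity : (2 * (m : ℝ) + 3) ≠ 0) ?_
      push_cast at h ⊢
      linear_combination (norm := (field_simp; ring)) h
  | succ n ih =>
    rw [← add_assoc, oddHarmonic_succ, H_succ]
    refine mul_left_cancel₀ (by positivity : (2 * (m : ℝ) + 2 * n + 3) ≠ 0) ?_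
    push_cast
    linear_combination (norm := (field_simp; ring)) 2 * (n + 1) * split m n -
      betaMoment_log_one_sub_sq_succ_left m n + 2 * (n + 1) * ih +
      betaMoment_one_succ_left m n / (n + 1) +
      (H n + 2 * Real.log 2 - 2 * oddHarmonic (m + n + 1)) * betaMoment_one_eq_mul_succ_right m n

theorem binomFactor_eq (k : ℕ) :
    binomFactor k = 8 ^ k * (2 * k)! ^ 2 * (3 * k)! / (k ! * (6 * k)!) := by
  rw [binomFactor, Nat.cast_choose ℝ (by lia : k ≤ 2 * k), Nat.cast_choose ℝ (by lia : k ≤ 3 * k),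
    Nat.cast_choose ℝ (by lia : 3 * k ≤ 6 * k), show 2 * k - k = k by lia,
    show 3 * k - k = 2 * k by lia, show 6 * k - 3 * k = 3 * k by lia]
  field_simp

theorem half_pow_mul_betaMoment_one (n : ℕ) :
    (1 / 2) ^ (n + 1) * betaMoment 1 n (2 * n + 2) = binomFactor (n + 1) / (2 * n + 1) := by
  rw [binomFactor_eq, betaMoment_one, show n + (2 * n + 2) + 1 = 3 * (n + 1) by ring,
    show 2 * n + 2 * (2 * n + 2) + 2 = 6 * (n + 1) by ring,
    show 2 * (n + 1) = 2 * n + 1 + 1 by ring, show 2 * n + 2 = 2 * n + 1 + 1 by ring,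
    show (8 : ℝ) ^ (n + 1) = 2 ^ (3 * (n + 1)) by rw [pow_mul]; norm_num]
  simp only [Nat.factorial_succ n, Nat.factorial_succ (2 * n), Nat.factorial_succ (2 * n + 1),
    one_div, inv_pow]
  push_cast
  field_simp
  ring

theorem half_pow_mul_betaMoment_one_succ (n : ℕ) :
    4 * (1 / 2) ^ (n + 1) * betaMoment 1 (n + 1) (2 * n + 1) = binomFactor (n + 1) / (n + 1) := by
  have first := half_pow_mul_betaMoment_one n
  have shift := betaMoment_one_succ_left n (2 * n + 1)
  rw [eq_div_iff (by positivity)] at first ⊢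
  push_cast at shift
  linear_combination first + (1 / 2) ^ (n + 1) * shift

theorem betaMoment_mul_sq_half_sub_log (n : ℕ) :
    (2 * n + 1) * betaMoment (fun y => (1 - 3 * y ^ 2) * (y ^ 2 / 2 - Real.log y)) n (2 * n) =
      betaMoment 1 n (2 * n + 2) := by
  set h : ℝ → ℝ := fun y => y ^ 2 / 2 - Real.log y
  have hh : IntervalIntegrable h volume 0 1 :=
    (Continuous.intervalIntegrable (by fun_prop) _ _).sub intervalIntegrable_log'
  have parts := betaMoment_add_betaMoment_eq (h := h) (g := fun y => -(1 - y ^ 2) ^ 2)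
    (((by fun_prop : Continuous fun y : ℝ => y * (1 - y ^ 2) * (y ^ 2 / 2)).sub
      (Real.continuous_mul_log.mul (by fun_prop : Continuous fun y : ℝ => 1 - y ^ 2))).congr
      fun y => by simp only [h, Pi.sub_apply, Pi.mul_apply]; ring).continuousOn
    (fun y hy => by
      have hy0 : y ≠ 0 := hy.1.ne'
      have : 1 - y ^ 2 ≠ 0 := by nlinarith [hy.1, hy.2]
      refine (((hasDerivAt_pow 2 y).div_const 2).sub (Real.hasDerivAt_log hy0)).congr_deriv ?_
      field_simp
      ring)
    hh (Continuous.intervalIntegrable (by fun_prop) _ _) n (2 * n)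
  have split : betaMoment (fun y => (1 - 3 * y ^ 2) * h y) n (2 * n) =
      betaMoment h n (2 * n + 1) - 2 * betaMoment h (n + 1) (2 * n) := by
    rw [betaMoment, betaMoment, betaMoment, ← intervalIntegral.integral_const_mul,
      ← integral_sub (hh.continuousOn_mul (by fun_prop))
        ((hh.continuousOn_mul (by fun_prop)).const_mul 2)]
    congr 1; ext y; ring
  have square : betaMoment (fun y => -(1 - y ^ 2) ^ 2) n (2 * n) = -betaMoment 1 n (2 * n + 2) := by
    simp [betaMoment, pow_add, mul_assoc]
  push_cast at parts
  linear_combination (2 * n + 1) * split + parts - square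

/-! ### The kernel `1 / ((2 - y²) (1 + y⁴))` -/

/-- The weight `1 / (2 - y²)`. -/
noncomputable def quadWeight (y : ℝ) : ℝ := 1 / (2 - y ^ 2)

/-- The weight `(1 + y²) / (1 + y⁴)`. -/
noncomputable def quarticWeightAdd (y : ℝ) : ℝ := (1 + y ^ 2) / (1 + y ^ 4)

/-- The weight `(1 - y²) / (1 + y⁴)`. -/
noncomputable def quarticWeightSub (y : ℝ) : ℝ := (1 - y ^ 2) / (1 + y ^ 4)

/-- The integral `∫₀¹ w(y) h(y) dy`, as a pairing of a weight with a function. -/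
noncomputable def pairing (w h : ℝ → ℝ) : ℝ := ∫ y in (0 : ℝ)..1, w y * h y

theorem two_sub_sq_pos {y : ℝ} (hy : y ∈ Icc (0 : ℝ) 1) : 0 < 2 - y ^ 2 := by
  nlinarith [hy.1, hy.2]

theorem continuousOn_quadWeight : ContinuousOn quadWeight (uIcc 0 1) := by
  rw [uIcc_of_le zero_le_one]
  exact continuousOn_const.div (by fun_prop) fun y hy => (two_sub_sq_pos hy).ne'

theorem continuous_quarticWeightAdd : Continuous quarticWeightAdd :=
  Continuous.div (by fun_prop) (by fun_prop) fun y => by positivity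

theorem continuous_quarticWeightSub : Continuous quarticWeightSub :=
  Continuous.div (by fun_prop) (by fun_prop) fun y => by positivity

theorem pairing_const_mul (w h : ℝ → ℝ) (c : ℝ) :
    pairing w (fun y => c * h y) = c * pairing w h := by
  simp only [pairing, mul_left_comm _ c, intervalIntegral.integral_const_mul]

theorem pairing_sub {w h₁ h₂ : ℝ → ℝ} (hw : ContinuousOn w (uIcc 0 1))
    (h₁_int : IntervalIntegrable h₁ volume 0 1) (h₂_int : IntervalIntegrable h₂ volume 0 1) :
    pairing w (fun y => h₁ y - h₂ y) = pairing w h₁ - pairing w h₂ := by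
  simp only [pairing, mul_sub]
  exact integral_sub (h₁_int.continuousOn_mul hw) (h₂_int.continuousOn_mul hw)

theorem hasSum_integral_pow_mul {a b r : ℝ} {q h : ℝ → ℝ} (hq : ContinuousOn q (uIcc a b))
    (hr : r < 1) (hqr : ∀ y ∈ uIcc a b, |q y| ≤ r) (hh : IntervalIntegrable h volume a b) :
    HasSum (fun n : ℕ => ∫ y in a..b, q y ^ n * h y) (∫ y in a..b, (1 - q y)⁻¹ * h y) := by
  have hr0 : 0 ≤ r := (abs_nonneg _).trans (hqr a left_mem_uIcc)
  have geometric : Summable fun n : ℕ => r ^ n := summable_geometric_of_lt_one hr0 hr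
  refine hasSum_integral_of_dominated_convergence (fun n y => r ^ n * |h y|)
    (fun n => ((hh.continuousOn_mul (hq.pow n)).def').aestronglyMeasurable)
    (fun n => .of_forall fun y hy => ?_) (.of_forall fun y _ => geometric.mul_right _) ?_
    (.of_forall fun y hy => ?_)
  · rw [norm_mul, norm_pow, Real.norm_eq_abs, Real.norm_eq_abs]
    gcongr
    exact hqr y (uIoc_subset_uIcc hy)
  · simp_rw [tsum_mul_right]
    exact hh.abs.const_mul _
  · exact (hasSum_geometric_of_abs_lt_one
      ((hqr y (uIoc_subset_uIcc hy)).trans_lt hr)).mul_right _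

theorem hasSum_half_pow_mul_betaMoment {h : ℝ → ℝ} (hh : IntervalIntegrable h volume 0 1) :
    HasSum (fun n : ℕ => (1 / 2) ^ (n + 1) * betaMoment h n (2 * n))
      (∫ y in (0 : ℝ)..1, h y / ((2 - y ^ 2) * (1 + y ^ 4))) := by
  have geometric := (hasSum_integral_pow_mul (a := 0) (b := 1) (r := 1 / 2)
    (q := fun y => y ^ 2 * (1 - y ^ 2) ^ 2 / 2)
    (by fun_prop) (by norm_num) (fun y hy => by
      rw [uIcc_of_le zero_le_one] at hy
      have hy2 : y ^ 2 ≤ 1 := pow_le_one₀ hy.1 hy.2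
      have hy4 : (1 - y ^ 2) ^ 2 ≤ 1 := pow_le_one₀ (by linarith) (by nlinarith)
      rw [abs_of_nonneg (by positivity)]
      linarith [mul_le_one₀ hy2 (sq_nonneg (1 - y ^ 2)) hy4]) hh).mul_left (1 / 2)
  have term (n : ℕ) : (1 / 2) ^ (n + 1) * betaMoment h n (2 * n) =
      1 / 2 * ∫ y in (0 : ℝ)..1, (y ^ 2 * (1 - y ^ 2) ^ 2 / 2) ^ n * h y := by
    rw [betaMoment, ← intervalIntegral.integral_const_mul, ← intervalIntegral.integral_const_mul]
    congr 1; ext y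
    rw [show y ^ 2 * (1 - y ^ 2) ^ 2 / 2 = 1 / 2 * (y ^ 2 * (1 - y ^ 2) ^ 2) by ring, mul_pow,
      mul_pow, ← pow_mul, ← pow_mul]
    ring
  have value : ∫ y in (0 : ℝ)..1, h y / ((2 - y ^ 2) * (1 + y ^ 4)) =
      1 / 2 * ∫ y in (0 : ℝ)..1, (1 - y ^ 2 * (1 - y ^ 2) ^ 2 / 2)⁻¹ * h y := by
    rw [← intervalIntegral.integral_const_mul]
    refine integral_congr fun y hy => ?_
    rw [uIcc_of_le zero_le_one] at hy
    have := two_sub_sq_pos hy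
    rw [show 1 - y ^ 2 * (1 - y ^ 2) ^ 2 / 2 = (2 - y ^ 2) * (1 + y ^ 4) / 2 by ring]
    field_simp
  simpa only [term, value] using geometric

theorem hasSum_half_pow_mul_betaMoment_partial_fractions {h : ℝ → ℝ}
    (hh : IntervalIntegrable h volume 0 1) (a b c : ℝ) :
    HasSum (fun n : ℕ => (1 / 2) ^ (n + 1) * betaMoment
        (fun y => (a * (1 + y ^ 4) + (b * (1 + y ^ 2) + c * (1 - y ^ 2)) * (2 - y ^ 2)) * h y)
        n (2 * n))
      (a * pairing quadWeight h + b * pairing quarticWeightAdd h +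
        c * pairing quarticWeightSub h) := by
  have weight : Continuous fun y : ℝ =>
      a * (1 + y ^ 4) + (b * (1 + y ^ 2) + c * (1 - y ^ 2)) * (2 - y ^ 2) := by fun_prop
  convert hasSum_half_pow_mul_betaMoment (hh.continuousOn_mul weight.continuousOn) using 1
  have quad := (hh.continuousOn_mul continuousOn_quadWeight).const_mul a
  have add := (hh.continuousOn_mul continuous_quarticWeightAdd.continuousOn).const_mul b
  have sub := (hh.continuousOn_mul continuous_quarticWeightSub.continuousOn).const_mul c
  simp only [pairing, ← intervalIntegral.integral_const_mul]
  rw [← intervalIntegral.integral_add quad add, ← intervalIntegral.integral_add (quad.add add) sub]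
  refine integral_congr fun y hy => ?_
  rw [uIcc_of_le zero_le_one] at hy
  have := two_sub_sq_pos hy
  simp only [quadWeight, quarticWeightAdd, quarticWeightSub]
  field_simp
  ring

theorem pairing_quadWeight_sq_half :
    pairing quadWeight (fun y => y ^ 2 / 2) = pairing quadWeight 1 - 1 / 2 := by
  have half : (1 / 2 : ℝ) = ∫ _ in (0 : ℝ)..1, (1 / 2 : ℝ) := by simp
  simp only [pairing, Pi.one_apply, mul_one]
  rw [half, ← integral_sub continuousOn_quadWeight.intervalIntegrable intervalIntegrable_const]
  refine integral_congr fun y hy => ?_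
  rw [uIcc_of_le zero_le_one] at hy
  have := two_sub_sq_pos hy
  simp only [quadWeight]
  field_simp
  ring

theorem pairing_quarticWeightSub_sq_half :
    pairing quarticWeightSub (fun y => y ^ 2 / 2) = (pairing quarticWeightAdd 1 - 1) / 2 := by
  have one : ∫ _ in (0 : ℝ)..1, (1 : ℝ) = 1 := by simp
  have difference := integral_sub (continuous_quarticWeightAdd.intervalIntegrable 0 1)
    (intervalIntegrable_const (μ := volume) (c := (1 : ℝ)))
  simp only [pairing, Pi.one_apply, mul_one]
  rw [one] at difference
  rw [← difference, ← intervalIntegral.integral_div]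
  congr 1; ext y
  simp only [quarticWeightSub, quarticWeightAdd]
  field_simp
  ring

/-! ### The dilogarithm -/

/-- The dilogarithm `Li₂(z) = -∫₀¹ log(1 - t z) dt / t`, the analytic continuation of `∑ zⁿ / n²`
to the complement of the ray `(1, ∞)`. -/
noncomputable def dilog (z : ℂ) : ℂ := ∫ t in (0 : ℝ)..1, -(Complex.log (1 - t * z) / t)

theorem one_sub_mul_mem_slitPlane {z : ℂ} (hz : 1 - z ∈ Complex.slitPlane) {t : ℝ}
    (ht : t ∈ Icc (0 : ℝ) 1) : 1 - (t : ℂ) * z ∈ Complex.slitPlane := by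
  convert Complex.starConvex_one_slitPlane hz (sub_nonneg.2 ht.2) ht.1 (sub_add_cancel 1 t) using 1
  simp only [Complex.real_smul]
  push_cast
  ring

theorem hasDerivAt_log_one_sub_mul {z : ℂ} {t : ℝ} (h : 1 - (t : ℂ) * z ∈ Complex.slitPlane) :
    HasDerivAt (fun s : ℝ => Complex.log (1 - (s : ℂ) * z)) (-z / (1 - t * z)) t := by
  have inner : HasDerivAt (fun s : ℂ => 1 - s * z) (-z) (t : ℂ) := by
    simpa using ((hasDerivAt_id (t : ℂ)).mul_const z).const_sub 1
  exact (inner.clog h).comp_ofReal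

theorem continuousOn_div_one_sub_mul {z : ℂ} (hz : 1 - z ∈ Complex.slitPlane) (c : ℂ) :
    ContinuousOn (fun t : ℝ => c / (1 - t * z)) (uIcc 0 1) := by
  rw [uIcc_of_le zero_le_one]
  exact continuousOn_const.div (by fun_prop) fun t ht =>
    Complex.slitPlane_ne_zero (one_sub_mul_mem_slitPlane hz ht)

theorem integral_div_one_sub_mul {z : ℂ} (hz : 1 - z ∈ Complex.slitPlane) :
    ∫ t in (0 : ℝ)..1, -z / (1 - t * z) = Complex.log (1 - z) := by
  rw [integral_eq_sub_of_hasDerivAt (fun t ht => hasDerivAt_log_one_sub_mul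
    (one_sub_mul_mem_slitPlane hz (uIcc_of_le (zero_le_one' ℝ) ▸ ht)))
    (continuousOn_div_one_sub_mul hz _).intervalIntegrable]
  simp

theorem intervalIntegrable_dilog {z : ℂ} (hz : 1 - z ∈ Complex.slitPlane) :
    IntervalIntegrable (fun t : ℝ => -(Complex.log (1 - t * z) / t)) volume 0 1 := by
  have slope : ContinuousOn (dslope (fun t : ℝ => Complex.log (1 - (t : ℂ) * z)) 0) (uIcc 0 1) := by
    intro t ht
    rw [uIcc_of_le zero_le_one] at ht
    have deriv := hasDerivAt_log_one_sub_mul (one_sub_mul_mem_slitPlane hz ht)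
    rcases eq_or_ne t 0 with rfl | ht0
    · exact (continuousAt_dslope_same.2 deriv.differentiableAt).continuousWithinAt
    · exact ((continuousAt_dslope_of_ne ht0).2 deriv.continuousAt).continuousWithinAt
  refine slope.intervalIntegrable.neg.congr_uIoo fun t ht => ?_
  rw [uIoo_of_le zero_le_one] at ht
  rw [Pi.neg_apply, dslope_of_ne _ ht.1.ne', slope_def_module]
  simp [div_eq_inv_mul]

theorem hasDerivAt_dilog_integral {z : ℂ} (hz : 1 - z ∈ Complex.slitPlane) :
    HasDerivAt dilog (∫ t in (0 : ℝ)..1, 1 / (1 - t * z)) z := by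
  have domain_open : IsOpen {w : ℂ | 1 - w ∈ Complex.slitPlane} :=
    Complex.isOpen_slitPlane.preimage (by fun_prop)
  obtain ⟨ε, hε, ball_subset⟩ :=
    Metric.nhds_basis_closedBall.mem_iff.mp (domain_open.mem_nhds hz)
  have integrand_continuous : ContinuousOn (fun p : ℝ × ℂ => 1 / (1 - (p.1 : ℂ) * p.2))
      (Icc (0 : ℝ) 1 ×ˢ Metric.closedBall z ε) :=
    continuousOn_const.div (by fun_prop) fun p hp =>
      Complex.slitPlane_ne_zero (one_sub_mul_mem_slitPlane (ball_subset hp.2) hp.1)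
  obtain ⟨C, hC⟩ := (isCompact_Icc.prod
    (isCompact_closedBall z ε)).exists_bound_of_continuousOn integrand_continuous
  refine (hasDerivAt_integral_of_dominated_loc_of_deriv_le (μ := volume) (bound := fun _ => C)
    (F := fun (w : ℂ) (t : ℝ) => -(Complex.log (1 - t * w) / t))
    (F' := fun (w : ℂ) (t : ℝ) => 1 / (1 - t * w)) (Metric.closedBall_mem_nhds z hε)
    (.of_forall fun w => (by fun_prop : Measurable _).aestronglyMeasurable)
    (intervalIntegrable_dilog hz) (by fun_prop : Measurable _).aestronglyMeasurable
    (.of_forall fun t ht w hw => ?_) intervalIntegrable_const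
    (.of_forall fun t ht w hw => ?_)).2 <;> rw [uIoc_of_le zero_le_one] at ht
  · exact hC (t, w) ⟨⟨ht.1.le, ht.2⟩, hw⟩
  · have mem := one_sub_mul_mem_slitPlane (ball_subset hw) (⟨ht.1.le, ht.2⟩ : t ∈ Icc (0 : ℝ) 1)
    have inner : HasDerivAt (fun s : ℂ => 1 - (t : ℂ) * s) (-t) w := by
      simpa using ((hasDerivAt_id w).const_mul (t : ℂ)).const_sub 1
    refine ((inner.clog mem).div_const (t : ℂ)).neg.congr_deriv ?_
    have ht0 : (t : ℂ) ≠ 0 := by exact_mod_cast ht.1.ne'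
    have := Complex.slitPlane_ne_zero mem
    field_simp

theorem continuousAt_dilog {z : ℂ} (hz : 1 - z ∈ Complex.slitPlane) : ContinuousAt dilog z :=
  (hasDerivAt_dilog_integral hz).continuousAt

theorem hasDerivAt_dilog {z : ℂ} (hz : 1 - z ∈ Complex.slitPlane) (h0 : z ≠ 0) :
    HasDerivAt dilog (-(Complex.log (1 - z) / z)) z := by
  refine (hasDerivAt_dilog_integral hz).congr_deriv ?_
  rw [← integral_div_one_sub_mul hz, ← neg_div, ← intervalIntegral.integral_neg,
    ← intervalIntegral.integral_div]
  congr 1; ext t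
  field_simp

theorem dilog_zero : dilog 0 = 0 := by simp [dilog]

theorem hasSum_dilog_integrand {z : ℂ} (hz : ‖z‖ ≤ 1) {t : ℝ} (ht : t ∈ Ioo (0 : ℝ) 1) :
    HasSum (fun n : ℕ => z ^ (n + 1) / (n + 1) * (t : ℂ) ^ n) (-(Complex.log (1 - t * z) / t)) := by
  have norm_lt : ‖(t : ℂ) * z‖ < 1 := by
    rw [norm_mul, Complex.norm_real, Real.norm_of_nonneg ht.1.le]
    exact mul_lt_one_of_nonneg_of_lt_one_left ht.1.le ht.2 hz
  have series := ((hasSum_nat_add_iff' 1).2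
    (Complex.hasSum_taylorSeries_neg_log norm_lt)).div_const (t : ℂ)
  have ht0 : (t : ℂ) ≠ 0 := by exact_mod_cast ht.1.ne'
  rw [Finset.sum_range_one, Nat.cast_zero, div_zero, sub_zero, neg_div] at series
  refine series.congr_fun fun n => ?_
  rw [mul_pow, pow_succ (t : ℂ)]
  push_cast
  field_simp

theorem hasSum_dilog {z : ℂ} (hz : ‖z‖ ≤ 1) :
    HasSum (fun n : ℕ => z ^ n / (n : ℂ) ^ 2) (dilog z) := by
  have integral_Ioo (f : ℝ → ℂ) : ∫ t in Ioo (0 : ℝ) 1, f t = ∫ t in (0 : ℝ)..1, f t := by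
    rw [integral_of_le zero_le_one, MeasureTheory.integral_Ioc_eq_integral_Ioo]
  have integral_pow_Ioo (n : ℕ) : ∫ t in Ioo (0 : ℝ) 1, t ^ n = 1 / ((n : ℝ) + 1) := by
    rw [← MeasureTheory.integral_Ioc_eq_integral_Ioo, ← integral_of_le zero_le_one]
    simp
  have interchange := MeasureTheory.hasSum_integral_of_summable_integral_norm
    (μ := volume.restrict (Ioo (0 : ℝ) 1))
    (F := fun (n : ℕ) t => z ^ (n + 1) / (n + 1) * (t : ℂ) ^ n)
    (fun n => (Continuous.integrableOn_Icc (by fun_prop)).mono_set Ioo_subset_Icc_self) ?_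
  · rw [MeasureTheory.setIntegral_congr_fun measurableSet_Ioo
      fun t ht => (hasSum_dilog_integrand hz ht).tsum_eq, integral_Ioo] at interchange
    refine (hasSum_nat_add_iff' 1).1 ?_
    rw [Finset.sum_range_one, Nat.cast_zero, zero_pow two_ne_zero, div_zero, sub_zero]
    refine interchange.congr_fun fun n => ?_
    have := integral_pow_Ioo n
    rw [MeasureTheory.integral_const_mul]
    simp only [← Complex.ofReal_pow]
    rw [integral_complex_ofReal, this]
    push_cast
    field_simp
  · refine ((summable_nat_add_iff 1).2 (Real.summable_one_div_nat_pow.2 one_lt_two)).of_nonneg_of_le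
      (fun n => MeasureTheory.integral_nonneg fun t => norm_nonneg _) fun n => ?_
    have norm_integral : ∫ t in Ioo (0 : ℝ) 1, ‖z ^ (n + 1) / (n + 1) * (t : ℂ) ^ n‖ =
        ‖z‖ ^ (n + 1) / ((n : ℝ) + 1) ^ 2 := by
      have norm_term (t : ℝ) (ht : t ∈ Ioo (0 : ℝ) 1) : ‖z ^ (n + 1) / (n + 1) * (t : ℂ) ^ n‖ =
          ‖z‖ ^ (n + 1) / (n + 1) * t ^ n := by
        rw [norm_mul, norm_div, norm_pow, norm_pow, Complex.norm_real,
          Real.norm_of_nonneg ht.1.le]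
        norm_cast
      rw [MeasureTheory.setIntegral_congr_fun measurableSet_Ioo norm_term,
        MeasureTheory.integral_const_mul, integral_pow_Ioo]
      field_simp
    rw [norm_integral]
    push_cast
    gcongr
    exact pow_le_one₀ (norm_nonneg _) hz

theorem dilog_add_dilog_neg {z : ℂ} (hz : ‖z‖ ≤ 1) :
    dilog z + dilog (-z) = dilog (z ^ 2) / 2 := by
  have left := (hasSum_dilog hz).add (hasSum_dilog (z := -z) (by rwa [norm_neg]))
  have right := hasSum_dilog (z := z ^ 2) (by rw [norm_pow]; exact pow_le_one₀ (norm_nonneg _) hz)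
  refine left.unique ?_
  rw [← add_zero (dilog (z ^ 2) / 2)]
  refine HasSum.even_add_odd ((right.div_const 2).congr_fun fun n => ?_)
    ((hasSum_zero (α := ℂ) (β := ℕ)).congr_fun fun n => ?_)
  · rw [pow_mul, pow_mul, neg_sq]
    push_cast
    ring
  · rw [Odd.neg_pow (by simp)]
    ring

theorem continuousAt_log_smul {E : Type*} [NormedAddCommGroup E] [NormedSpace ℝ E] {f : ℝ → E}
    (hf : DifferentiableAt ℝ f 0) (h0 : f 0 = 0) :
    ContinuousAt (fun x => Real.log x • f x) 0 := by
  have factor : (fun x => Real.log x • f x) = fun x => (x * Real.log x) • dslope f 0 x := by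
    ext x
    rcases eq_or_ne x 0 with rfl | hx
    · simp
    · rw [dslope_of_ne _ hx, slope_def_module, h0, smul_smul, sub_zero, sub_zero]
      field_simp
  rw [factor]
  exact Real.continuous_mul_log.continuousAt.smul (continuousAt_dslope_same.2 hf)

theorem continuousOn_log_smul {E : Type*} [NormedAddCommGroup E] [NormedSpace ℝ E] {f : ℝ → E}
    {s : Set ℝ} (hf : ContinuousOn f s) (hd : DifferentiableAt ℝ f 0) (h0 : f 0 = 0) :
    ContinuousOn (fun x => Real.log x • f x) s := by
  intro x hx
  rcases eq_or_ne x 0 with rfl | hx0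
  · exact (continuousAt_log_smul hd h0).continuousWithinAt
  · exact (Real.continuousAt_log hx0).continuousWithinAt.smul (hf x hx)

theorem intervalIntegrable_log_mul_div_one_sub_mul {z : ℂ} (hz : 1 - z ∈ Complex.slitPlane) :
    IntervalIntegrable (fun t : ℝ => Real.log t * (z / (1 - t * z))) volume 0 1 := by
  have log_integrable : IntervalIntegrable (fun t : ℝ => (Real.log t : ℂ)) volume 0 1 :=
    ⟨intervalIntegrable_log'.1.ofReal, intervalIntegrable_log'.2.ofReal⟩
  exact log_integrable.mul_continuousOn (continuousOn_div_one_sub_mul hz z)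

theorem integral_log_mul_div_one_sub_mul {z : ℂ} (hz : 1 - z ∈ Complex.slitPlane) :
    ∫ t in (0 : ℝ)..1, Real.log t * (z / (1 - t * z)) = -dilog z := by
  have mem {t : ℝ} (ht : t ∈ Icc (0 : ℝ) 1) := one_sub_mul_mem_slitPlane hz ht
  have log_deriv {t : ℝ} (ht : t ∈ Icc (0 : ℝ) 1) := hasDerivAt_log_one_sub_mul (mem ht)
  rcases eq_or_ne z 0 with rfl | hz0
  · simp [dilog_zero]
  have ftc := integral_eq_sub_of_hasDerivAt_of_le zero_le_one
    (f := fun t : ℝ => -(Real.log t • Complex.log (1 - t * z)) - dilog (t * z))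
    (f' := fun t : ℝ => Real.log t * (z / (1 - t * z))) ?_ (fun t ht => ?_) ?_
  · rw [ftc]
    simp [dilog_zero]
  · refine (continuousOn_log_smul (fun t ht => (log_deriv ht).continuousAt.continuousWithinAt)
      (log_deriv ⟨le_rfl, zero_le_one⟩).differentiableAt (by simp)).neg.sub fun t ht => ?_
    exact ((continuousAt_dilog (mem ht)).comp (f := fun t : ℝ => (t : ℂ) * z)
      (by fun_prop)).continuousWithinAt
  · have ht0 : (t : ℂ) ≠ 0 := by exact_mod_cast ht.1.ne'
    have inner : HasDerivAt (fun s : ℝ => (s : ℂ) * z) z t := by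
      simpa using (hasDerivAt_id t).ofReal_comp.mul_const z
    refine (((Real.hasDerivAt_log ht.1.ne').smul (log_deriv ⟨ht.1.le, ht.2.le⟩)).neg.sub
      ((hasDerivAt_dilog (mem ⟨ht.1.le, ht.2.le⟩) (mul_ne_zero ht0 hz0)).comp t
        inner)).congr_deriv ?_
    have := Complex.slitPlane_ne_zero (mem ⟨ht.1.le, ht.2.le⟩)
    simp only [Complex.real_smul, Complex.ofReal_inv]
    field_simp
    ring
  · exact intervalIntegrable_log_mul_div_one_sub_mul hz

/-- The Legendre chi function `χ₂(z) = ∑ z^(2n+1) / (2n+1)²`, the odd part of the dilogarithm. -/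
noncomputable def legendreChi (z : ℂ) : ℂ := (dilog z - dilog (-z)) / 2

theorem integral_log_mul_div_one_sub_sq {z : ℂ} (hz : 1 - z ∈ Complex.slitPlane)
    (hz' : 1 + z ∈ Complex.slitPlane) :
    ∫ t in (0 : ℝ)..1, Real.log t * (z / (1 - (t * z) ^ 2)) = -legendreChi z := by
  rw [← sub_neg_eq_add] at hz'
  have value : -legendreChi z = ((∫ t in (0 : ℝ)..1, Real.log t * (z / (1 - t * z))) -
      ∫ t in (0 : ℝ)..1, Real.log t * (-z / (1 - t * -z))) / 2 := by
    rw [integral_log_mul_div_one_sub_mul hz, integral_log_mul_div_one_sub_mul hz', legendreChi]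
    ring
  rw [value, ← integral_sub (intervalIntegrable_log_mul_div_one_sub_mul hz)
    (intervalIntegrable_log_mul_div_one_sub_mul hz'), ← intervalIntegral.integral_div]
  refine integral_congr fun t ht => ?_
  rw [uIcc_of_le zero_le_one] at ht
  have minus := Complex.slitPlane_ne_zero (one_sub_mul_mem_slitPlane hz ht)
  have plus := Complex.slitPlane_ne_zero (one_sub_mul_mem_slitPlane hz' ht)
  rw [mul_comm] at minus
  rw [mul_neg, sub_neg_eq_add, mul_comm] at plus
  have factor : 1 - ((t : ℂ) * z) ^ 2 = (1 - t * z) * (1 + t * z) := by ring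
  simp only [factor, mul_neg, sub_neg_eq_add]
  field_simp
  ring

/-! ### Functional equations on the real line -/

theorem eq_of_hasDerivAt_zero {f : ℝ → ℝ} {a b : ℝ} (hab : a ≤ b) (hc : ContinuousOn f (Icc a b))
    (hd : ∀ x ∈ Ioo a b, HasDerivAt f 0 x) : f a = f b := by
  have ftc := integral_eq_sub_of_hasDerivAt_of_le hab hc hd intervalIntegrable_const
  rw [intervalIntegral.integral_zero] at ftc
  linarith

/-- The real part of the dilogarithm as a function on `(-∞, 1]`. -/
noncomputable def reDilog (x : ℝ) : ℝ := (dilog x).re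

/-- The real part of the Legendre chi function as a function on `[-1, 1]`. -/
noncomputable def reChi (x : ℝ) : ℝ := (reDilog x - reDilog (-x)) / 2

theorem one_sub_ofReal_mem_slitPlane {x : ℝ} (hx : x < 1) : 1 - (x : ℂ) ∈ Complex.slitPlane := by
  rw [← Complex.ofReal_one, ← Complex.ofReal_sub]
  exact Complex.ofReal_mem_slitPlane.2 (sub_pos.2 hx)

theorem hasDerivAt_reDilog {x : ℝ} (hx : x < 1) (h0 : x ≠ 0) :
    HasDerivAt reDilog (-(Real.log (1 - x) / x)) x := by
  refine (hasDerivAt_dilog (one_sub_ofReal_mem_slitPlane hx)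
    (by exact_mod_cast h0)).real_of_complex.congr_deriv ?_
  rw [← Complex.ofReal_one, ← Complex.ofReal_sub, ← Complex.ofReal_log (by linarith)]
  norm_cast

theorem continuousAt_reDilog {x : ℝ} (hx : x < 1) : ContinuousAt reDilog x :=
  Complex.continuous_re.continuousAt.comp ((continuousAt_dilog
    (one_sub_ofReal_mem_slitPlane hx)).comp Complex.continuous_ofReal.continuousAt)

theorem hasSum_reDilog {x : ℝ} (hx : |x| ≤ 1) :
    HasSum (fun n : ℕ => x ^ n / (n : ℝ) ^ 2) (reDilog x) :=
  (Complex.hasSum_re (hasSum_dilog (z := x) (by simpa using hx))).congr_fun fun n => by norm_cast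

theorem continuousOn_reDilog : ContinuousOn reDilog (Icc 0 1) := by
  refine ContinuousOn.congr (f := fun x : ℝ => ∑' n : ℕ, x ^ n / (n : ℝ) ^ 2) ?_
    fun x hx => (hasSum_reDilog (abs_le.2 ⟨by linarith [hx.1], hx.2⟩)).tsum_eq.symm
  refine continuousOn_tsum (fun n => by fun_prop) (Real.summable_one_div_nat_pow.2 one_lt_two)
    fun n x hx => ?_
  rw [norm_div, norm_pow, Real.norm_of_nonneg hx.1, Real.norm_of_nonneg (by positivity)]
  gcongr
  exact pow_le_one₀ hx.1 hx.2

theorem reDilog_zero : reDilog 0 = 0 := by simp [reDilog, dilog_zero]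

theorem reDilog_one : reDilog 1 = π ^ 2 / 6 := by
  have series := hasSum_reDilog (x := 1) (by simp)
  simp only [one_pow] at series
  exact series.unique hasSum_zeta_two

theorem reDilog_add_reDilog_neg {x : ℝ} (hx : |x| ≤ 1) :
    reDilog x + reDilog (-x) = reDilog (x ^ 2) / 2 := by
  have duplication := congrArg Complex.re (dilog_add_dilog_neg (z := x) (by simpa using hx))
  simpa [reDilog] using duplication

theorem reDilog_neg_one : reDilog (-1) = -(π ^ 2 / 12) := by
  have duplication := reDilog_add_reDilog_neg (x := 1) (by simp)
  rw [one_pow, reDilog_one] at duplication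
  linarith

theorem reDilog_landen {x : ℝ} (hx : 0 ≤ x) :
    reDilog (-x) + reDilog (x / (1 + x)) + Real.log (1 + x) ^ 2 / 2 = 0 := by
  have div_lt {y : ℝ} (hy : 0 ≤ y) : y / (1 + y) < 1 := by
    rw [div_lt_one (by positivity)]; linarith
  have const := eq_of_hasDerivAt_zero
    (f := fun x => reDilog (-x) + reDilog (x / (1 + x)) + Real.log (1 + x) ^ 2 / 2) hx
    (fun y hy => ?_) fun y hy => ?_
  · simpa [reDilog_zero] using const.symm
  · have hy1 : 1 + y ≠ 0 := by linarith [hy.1]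
    have outer : ContinuousAt reDilog (-y) := continuousAt_reDilog (by linarith [hy.1])
    have quotient : ContinuousAt (fun z : ℝ => z / (1 + z)) y := by fun_prop (disch := assumption)
    exact (((outer.comp continuousAt_neg).add
      (ContinuousAt.comp (f := fun z => z / (1 + z)) (continuousAt_reDilog (div_lt hy.1))
        quotient)).add (by fun_prop (disch := assumption))).continuousWithinAt
  · have hy0 : 0 < y := hy.1
    have hy1 : 0 < 1 + y := by linarith
    have shift : HasDerivAt (fun z : ℝ => 1 + z) 1 y := (hasDerivAt_id y).const_add 1
    refine (((hasDerivAt_reDilog (x := -y) (by linarith) (by linarith)).comp y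
      (hasDerivAt_neg y)).add ((hasDerivAt_reDilog (div_lt hy0.le) (by positivity)).comp y
        ((hasDerivAt_id y).div shift hy1.ne'))).add
      (((shift.log hy1.ne').pow 2).div_const 2) |>.congr_deriv ?_
    have complement : 1 - y / (1 + y) = (1 + y)⁻¹ := by field_simp; ring
    simp only [id, complement, Real.log_inv, sub_neg_eq_add]
    field_simp
    ring

theorem reDilog_half : reDilog (1 / 2) = π ^ 2 / 12 - Real.log 2 ^ 2 / 2 := by
  have landen := reDilog_landen zero_le_one
  rw [reDilog_neg_one, one_add_one_eq_two] at landen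
  linarith

theorem hasDerivAt_reChi {x : ℝ} (h0 : 0 < x) (h1 : x < 1) :
    HasDerivAt reChi ((Real.log (1 + x) - Real.log (1 - x)) / (2 * x)) x := by
  refine (((hasDerivAt_reDilog h1 h0.ne').sub ((hasDerivAt_reDilog (x := -x) (by linarith)
    (by linarith)).comp x (hasDerivAt_neg x))).div_const 2).congr_deriv ?_
  rw [sub_neg_eq_add]
  field_simp
  ring

theorem continuousOn_reChi : ContinuousOn reChi (Icc 0 1) := by
  refine (continuousOn_reDilog.sub fun x hx => ?_).div_const 2
  exact ((continuousAt_reDilog (by linarith [hx.1])).comp continuousAt_neg).continuousWithinAt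

theorem reChi_add_reChi {x : ℝ} (h0 : 0 < x) (h1 : x < 1) :
    reChi x + reChi ((1 - x) / (1 + x)) =
      π ^ 2 / 8 + Real.log x * (Real.log (1 + x) - Real.log (1 - x)) / 2 := by
  have const := eq_of_hasDerivAt_zero (f := fun x => reChi x + reChi ((1 - x) / (1 + x)) -
    (Real.log x • (Real.log (1 + x) - Real.log (1 - x))) / 2) h0.le ?_ fun y hy => ?_
  · simp only [reChi, neg_zero, sub_zero, add_zero, div_one, reDilog_zero, reDilog_one,
      reDilog_neg_one, Real.log_zero, zero_div, smul_eq_mul] at const ⊢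
    linarith
  · have mobius : ContinuousOn (fun y : ℝ => (1 - y) / (1 + y)) (Icc 0 x) :=
      ContinuousOn.div (by fun_prop) (by fun_prop) fun y hy => by linarith [hy.1]
    have logs : ContinuousOn (fun y => Real.log (1 + y) - Real.log (1 - y)) (Icc 0 x) :=
      ContinuousOn.sub (.log (by fun_prop) fun y hy => by linarith [hy.1])
        (.log (by fun_prop) fun y hy => by linarith [hy.2])
    refine ((continuousOn_reChi.mono (Icc_subset_Icc_right h1.le)).add
      (continuousOn_reChi.comp mobius fun y hy => ?_)).sub
      ((continuousOn_log_smul logs ?_ (by simp)).div_const 2)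
    · have hy1 : 0 < 1 + y := by linarith [hy.1]
      exact ⟨div_nonneg (by linarith [hy.2]) hy1.le, (div_le_one hy1).2 (by linarith [hy.1])⟩
    · exact ((by fun_prop : DifferentiableAt ℝ (fun y : ℝ => 1 + y) 0).log (by simp)).sub
        ((by fun_prop : DifferentiableAt ℝ (fun y : ℝ => 1 - y) 0).log (by simp))
  · have hy0 : 0 < y := hy.1
    have minus_pos : 0 < 1 - y := by linarith [hy.2]
    have plus_pos : 0 < 1 + y := by linarith
    have minus : HasDerivAt (fun z : ℝ => 1 - z) (-1) y := (hasDerivAt_id y).const_sub 1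
    have plus : HasDerivAt (fun z : ℝ => 1 + z) 1 y := (hasDerivAt_id y).const_add 1
    have mobius_lt_one : (1 - y) / (1 + y) < 1 := (div_lt_one plus_pos).2 (by linarith)
    refine (((hasDerivAt_reChi hy0 (by linarith)).add
      ((hasDerivAt_reChi (div_pos minus_pos plus_pos) mobius_lt_one).comp y
        (minus.div plus plus_pos.ne'))).sub
      (((Real.hasDerivAt_log hy0.ne').smul
        ((plus.log plus_pos.ne').sub (minus.log minus_pos.ne'))).div_const 2)).congr_deriv ?_
    have one_sub_mobius : 1 - (1 - y) / (1 + y) = 2 * y / (1 + y) := by field_simp; ring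
    have one_add_mobius : 1 + (1 - y) / (1 + y) = 2 / (1 + y) := by field_simp; ring
    rw [one_sub_mobius, one_add_mobius, Real.log_div two_ne_zero plus_pos.ne',
      Real.log_div (mul_pos two_pos hy0).ne' plus_pos.ne', Real.log_mul two_ne_zero hy0.ne',
      smul_eq_mul, smul_eq_mul, Pi.sub_apply]
    field_simp
    ring

/-- `ρ = √2 - 1`, the fixed point in `(0, 1)` of the involution `x ↦ (1 - x) / (1 + x)`. -/
noncomputable def rho : ℝ := √2 - 1

theorem sqrt_two_eq : √(2 : ℝ) = rho + 1 := by rw [rho]; ring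

theorem rho_sq : rho ^ 2 = 1 - 2 * rho := by
  have := Real.sq_sqrt (zero_le_two (α := ℝ))
  rw [sqrt_two_eq] at this
  linarith

theorem rho_pos : 0 < rho := sub_pos.2 Real.one_lt_sqrt_two

theorem rho_lt_half : rho < 1 / 2 := by nlinarith [rho_sq, rho_pos]

theorem log_one_add_sqrt_two : Real.log (1 + √2) = -Real.log rho := by
  have inv : 1 + √2 = rho⁻¹ :=
    eq_inv_of_mul_eq_one_left (by linear_combination rho * sqrt_two_eq + rho_sq)
  rw [inv, Real.log_inv]

theorem log_sqrt_two : Real.log √2 = Real.log 2 / 2 := Real.log_sqrt zero_le_two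

theorem reDilog_rho_sq :
    reDilog (rho ^ 2) = 4 * reDilog rho + Real.log (1 + √2) ^ 2 - π ^ 2 / 4 := by
  have hρ0 := rho_pos
  have hρ1 := rho_lt_half
  have legendre := reChi_add_reChi hρ0 (by linarith)
  have fixed : (1 - rho) / (1 + rho) = rho := by
    rw [div_eq_iff (by linarith)]; linarith [rho_sq]
  have log_one_sub : Real.log (1 - rho) = Real.log rho + Real.log (1 + rho) := by
    rw [← Real.log_mul hρ0.ne' (by linarith)]; congr 1; linarith [rho_sq]
  have duplication := reDilog_add_reDilog_neg (x := rho) (by rw [abs_of_pos hρ0]; linarith)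
  rw [fixed, log_one_sub, reChi] at legendre
  rw [log_one_add_sqrt_two]
  linarith

theorem reChi_sqrt_two_div_two :
    2 * reChi (√2 / 2) = reDilog (1 / 2) / 2 + 2 * reDilog rho +
      (Real.log (1 + √2) - Real.log 2 / 2) ^ 2 := by
  have sqrt_pos : 0 < √(2 : ℝ) := by positivity
  have sq : √(2 : ℝ) ^ 2 = 2 := Real.sq_sqrt zero_le_two
  have duplication := reDilog_add_reDilog_neg (x := √2 / 2)
    (by rw [abs_of_pos (by positivity)]; nlinarith)
  have landen := reDilog_landen (x := √2 / 2) (by positivity)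
  have quotient : √2 / 2 / (1 + √2 / 2) = rho := by
    rw [rho, div_eq_iff (by positivity)]; linarith
  have log_one_add : Real.log (1 + √2 / 2) = Real.log (1 + √2) - Real.log 2 / 2 := by
    rw [← log_sqrt_two, ← Real.log_div (by positivity) sqrt_pos.ne']
    congr 1
    field_simp
    linarith
  rw [quotient, log_one_add] at landen
  rw [div_pow, sq, show (2 : ℝ) / 2 ^ 2 = 1 / 2 by norm_num] at duplication
  rw [reChi]
  linarith

/-! ### Real parts of dilogarithms along curves -/

theorem hasDerivAt_re_dilog_comp {f : ℝ → ℂ} {f' : ℂ} {x : ℝ} (hf : HasDerivAt f f' x)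
    (hs : 1 - f x ∈ Complex.slitPlane) (h0 : f x ≠ 0) :
    HasDerivAt (fun t => (dilog (f t)).re) (-(Complex.log (1 - f x) * (f' / f x)).re) x := by
  refine (Complex.reCLM.hasFDerivAt.comp_hasDerivAt x
    ((hasDerivAt_dilog hs h0).comp x hf)).congr_deriv ?_
  rw [Complex.reCLM_apply, ← Complex.neg_re]
  congr 1
  ring

theorem one_sub_mem_slitPlane_of_im_ne_zero {z : ℂ} (h : z.im ≠ 0) :
    1 - z ∈ Complex.slitPlane :=
  Complex.mem_slitPlane_iff.2 (Or.inr (by simpa using h))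

theorem norm_one_sub_inv_mul {w : ℂ} (hw : ‖w‖ = 1) {x : ℝ} (hx : 0 < x) :
    ‖1 - ((x⁻¹ : ℝ) : ℂ) * w‖ = ‖1 - (x : ℂ) * w‖ / x := by
  have conj_mul : (starRingEnd ℂ) w * w = 1 := by
    rw [mul_comm, Complex.mul_conj, Complex.normSq_eq_norm_sq, hw]; norm_num
  have mul_inv : (x : ℂ) * ((x⁻¹ : ℝ) : ℂ) = 1 := by exact_mod_cast mul_inv_cancel₀ hx.ne'
  have factor : 1 - ((x⁻¹ : ℝ) : ℂ) * w =
      (starRingEnd ℂ) (1 - x * w) * (-w * ((x⁻¹ : ℝ) : ℂ)) := by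
    simp only [map_sub, map_one, map_mul, Complex.conj_ofReal]
    linear_combination (-1 : ℂ) * conj_mul - (starRingEnd ℂ) w * w * mul_inv
  rw [factor, norm_mul, norm_mul, Complex.norm_conj, norm_neg, hw, one_mul, Complex.norm_real,
    norm_inv, Real.norm_of_nonneg hx.le, div_eq_mul_inv]

theorem re_dilog_mul_add_re_dilog_inv_mul {w : ℂ} (hw : ‖w‖ = 1) (him : w.im ≠ 0) {x : ℝ}
    (hx : 0 < x) :
    (dilog (x * w)).re + (dilog ((x⁻¹ : ℝ) * w)).re + Real.log x ^ 2 / 2 = 2 * (dilog w).re := by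
  have w_ne : w ≠ 0 := by rintro rfl; exact him rfl
  have deriv {g : ℝ → ℝ} {g' y : ℝ} (hg : HasDerivAt g g' y) (hg0 : g y ≠ 0) :
      HasDerivAt (fun t => (dilog (g t * w)).re) (-(Real.log ‖1 - g y * w‖ * (g' / g y))) y := by
    refine (hasDerivAt_re_dilog_comp (hg.ofReal_comp.mul_const w)
      (one_sub_mem_slitPlane_of_im_ne_zero (by simpa using ⟨hg0, him⟩))
      (mul_ne_zero (by exact_mod_cast hg0) w_ne)).congr_deriv ?_
    rw [mul_div_mul_right _ _ w_ne, ← Complex.ofReal_div, Complex.re_mul_ofReal, Complex.log_re]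
  have zero_deriv {y : ℝ} (hy : y ∈ Ioi (0 : ℝ)) : HasDerivAt (fun x : ℝ => (dilog (x * w)).re +
      (dilog ((x⁻¹ : ℝ) * w)).re + Real.log x ^ 2 / 2) 0 y := by
    have hy0 : y ≠ 0 := ne_of_gt hy
    refine (((deriv (hasDerivAt_id y) hy0).add (deriv (hasDerivAt_inv hy0) (inv_ne_zero hy0))).add
      (((Real.hasDerivAt_log hy0).pow 2).div_const 2)).congr_deriv ?_
    have norm_pos : ‖1 - (y : ℂ) * w‖ ≠ 0 := norm_ne_zero_iff.2 (Complex.slitPlane_ne_zero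
      (one_sub_mem_slitPlane_of_im_ne_zero (by simpa using ⟨hy0, him⟩)))
    rw [norm_one_sub_inv_mul hw hy, Real.log_div norm_pos hy0]
    simp only [id]
    field_simp
    ring
  have const := isOpen_Ioi.is_const_of_deriv_eq_zero isPreconnected_Ioi
    (fun y hy => (zero_deriv hy).differentiableAt.differentiableWithinAt)
    (fun y hy => (zero_deriv hy).deriv) (mem_Ioi.2 hx) (mem_Ioi.2 one_pos)
  simpa [two_mul] using const

theorem re_dilog_of_re_eq_half {z : ℂ} (hz : z.re = 1 / 2) :
    (dilog z).re = π ^ 2 / 12 - ‖Complex.log z‖ ^ 2 / 2 := by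
  set line : ℝ → ℂ := fun y => 1 / 2 + y * Complex.I
  have line_re (y : ℝ) : (line y).re = 1 / 2 := by simp [line]
  have mem (y : ℝ) : line y ∈ Complex.slitPlane := Or.inl (by rw [line_re]; norm_num)
  have reflect (y : ℝ) : 1 - line y = (starRingEnd ℂ) (line y) := by
    norm_num [line, Complex.ext_iff]
  have line_deriv (y : ℝ) : HasDerivAt line Complex.I y :=
    (((hasDerivAt_id y).ofReal_comp.mul_const Complex.I).const_add (1 / 2 : ℂ)).congr_deriv
      (by simp)
  have log_conj (y : ℝ) : Complex.log (1 - line y) = (starRingEnd ℂ) (Complex.log (line y)) := by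
    rw [reflect, Complex.log_conj _ (Complex.slitPlane_arg_ne_pi (mem y))]
  have zero_deriv (y : ℝ) :
      HasDerivAt (fun y => (dilog (line y)).re + ‖Complex.log (line y)‖ ^ 2 / 2) 0 y := by
    have one_sub_mem : 1 - line y ∈ Complex.slitPlane :=
      Or.inl (by rw [Complex.sub_re, line_re]; norm_num)
    refine ((hasDerivAt_re_dilog_comp (line_deriv y) one_sub_mem (Complex.slitPlane_ne_zero
      (mem y))).add ((((line_deriv y).clog_real (mem y)).norm_sq).div_const 2)).congr_deriv ?_
    rw [log_conj, Complex.inner, mul_div_cancel_left₀ _ two_ne_zero, mul_comm]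
    simp
  have const := is_const_of_deriv_eq_zero (fun y => (zero_deriv y).differentiableAt)
    (fun y => (zero_deriv y).deriv) z.im 0
  have at_im : line z.im = z := by apply Complex.ext <;> simp [line, hz]
  have at_zero : line 0 = ((1 / 2 : ℝ) : ℂ) := by simp [line]
  have log_half : ‖Complex.log ((1 / 2 : ℝ) : ℂ)‖ ^ 2 = Real.log 2 ^ 2 := by
    rw [← Complex.ofReal_log (by norm_num), Complex.norm_real, Real.norm_eq_abs, sq_abs, one_div,
      Real.log_inv, neg_sq]
  have half := reDilog_half
  rw [reDilog] at half
  simp only [at_im, at_zero, log_half, half] at const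
  linarith

theorem one_sub_exp_mul_I (α : ℝ) : 1 - Complex.exp (α * Complex.I) =
    (2 * Real.sin (α / 2) : ℝ) * Complex.exp (((α - π) / 2 : ℝ) * Complex.I) := by
  have double : α = 2 * (α / 2) := by ring
  have quarter : (α - π) / 2 = α / 2 - π / 2 := by ring
  apply Complex.ext
  · rw [Complex.sub_re, Complex.re_ofReal_mul, Complex.exp_ofReal_mul_I_re,
      Complex.exp_ofReal_mul_I_re, Complex.one_re, quarter, Real.cos_sub_pi_div_two]
    nth_rw 1 [double]
    rw [Real.cos_two_mul]
    linarith [Real.sin_sq_add_cos_sq (α / 2)]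
  · rw [Complex.sub_im, Complex.im_ofReal_mul, Complex.exp_ofReal_mul_I_im,
      Complex.exp_ofReal_mul_I_im, Complex.one_im, quarter, Real.sin_sub_pi_div_two]
    nth_rw 1 [double]
    rw [Real.sin_two_mul]
    ring

theorem log_ofReal_mul_exp_mul_I {r α : ℝ} (hr : 0 < r) (hα : α ∈ Ioc (-π) π) :
    Complex.log (r * Complex.exp (α * Complex.I)) = Real.log r + α * Complex.I := by
  rw [Complex.log_ofReal_mul hr (Complex.exp_ne_zero _), Complex.log_exp] <;> simp [hα.1, hα.2]

theorem log_one_sub_exp_mul_I {α : ℝ} (h0 : 0 < α) (h1 : α < 2 * π) :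
    Complex.log (1 - Complex.exp (α * Complex.I)) =
      Real.log (2 * Real.sin (α / 2)) + ((α - π) / 2 : ℝ) * Complex.I := by
  rw [one_sub_exp_mul_I, log_ofReal_mul_exp_mul_I]
  · linarith [Real.sin_pos_of_pos_of_lt_pi (x := α / 2) (by linarith) (by linarith)]
  · constructor <;> linarith

theorem one_sub_two_cos_sub_one_mul_exp_mul_I (α : ℝ) :
    1 - (2 * Real.cos α - 1 : ℝ) * Complex.exp (α * Complex.I) =
      (2 * Real.sin (α / 2) : ℝ) * Complex.exp ((3 * α / 2 - π / 2 : ℝ) * Complex.I) := by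
  have two_cos : ((2 * Real.cos α : ℝ) : ℂ) * Complex.exp (α * Complex.I) =
      Complex.exp (α * Complex.I) * Complex.exp (α * Complex.I) + 1 := by
    have inverse : Complex.exp (-α * Complex.I) * Complex.exp (α * Complex.I) = 1 := by
      rw [← Complex.exp_add]; simp
    push_cast
    rw [Complex.two_cos]
    linear_combination inverse
  have factor : 1 - (2 * Real.cos α - 1 : ℝ) * Complex.exp (α * Complex.I) =
      (1 - Complex.exp (α * Complex.I)) * Complex.exp (α * Complex.I) := by
    push_cast at two_cos ⊢
    linear_combination -two_cos
  rw [factor, one_sub_exp_mul_I, mul_assoc, ← Complex.exp_add]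
  congr 2
  push_cast
  ring

theorem log_one_sub_two_cos_sub_one_mul_exp {α : ℝ} (h0 : 0 < α) (h1 : α < π) :
    Complex.log (1 - (2 * Real.cos α - 1 : ℝ) * Complex.exp (α * Complex.I)) =
      Real.log (2 * Real.sin (α / 2)) + (3 * α / 2 - π / 2 : ℝ) * Complex.I := by
  rw [one_sub_two_cos_sub_one_mul_exp_mul_I, log_ofReal_mul_exp_mul_I]
  · linarith [Real.sin_pos_of_pos_of_lt_pi (x := α / 2) (by linarith) (by linarith)]
  · constructor <;> linarith

theorem one_sub_two_cos_sub_one_mul_exp_mem_slitPlane {α : ℝ} (h0 : 0 < α) (h1 : α < π) :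
    1 - (2 * Real.cos α - 1 : ℝ) * Complex.exp (α * Complex.I) ∈ Complex.slitPlane := by
  have sin_pos : 0 < Real.sin (α / 2) := Real.sin_pos_of_pos_of_lt_pi (by linarith) (by linarith)
  rw [Complex.mem_slitPlane_iff_arg, ← Complex.log_im, log_one_sub_two_cos_sub_one_mul_exp h0 h1,
    one_sub_two_cos_sub_one_mul_exp_mul_I]
  refine ⟨?_, mul_ne_zero (Complex.ofReal_ne_zero.2 (by positivity)) (Complex.exp_ne_zero _)⟩
  simp only [Complex.add_im, Complex.ofReal_im, Complex.im_ofReal_mul, Complex.I_im]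
  linarith

theorem polar_logDeriv {r : ℝ} (hr : r ≠ 0) (r' α : ℝ) :
    (r' * Complex.exp (α * Complex.I) + r * (Complex.exp (α * Complex.I) * Complex.I)) /
      (r * Complex.exp (α * Complex.I)) = ((r' / r : ℝ) : ℂ) + Complex.I := by
  have := Complex.exp_ne_zero (α * Complex.I)
  have : (r : ℂ) ≠ 0 := by exact_mod_cast hr
  rw [Complex.ofReal_div]
  field_simp

/-- On the curve `z = (2 cos α - 1) e^{iα}` the argument of `1 - z` is affine in `α`, and `|1 - z|²`
is one minus the real number `2 cos α - 1`; this ties `Re Li₂ z` to a real dilogarithm. -/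
theorem hasDerivAt_re_dilog_two_cos_sub_one_mul_exp {α : ℝ} (h0 : 0 < α) (h1 : α < π / 3) :
    HasDerivAt (fun a : ℝ =>
      (dilog ((2 * Real.cos a - 1 : ℝ) * Complex.exp (a * Complex.I))).re -
        reDilog (2 * Real.cos a - 1) / 2) (3 * α / 2 - π / 2) α := by
  have sin_pos : 0 < Real.sin (α / 2) := Real.sin_pos_of_pos_of_lt_pi (by linarith) (by linarith)
  have half_lt_cos : 1 / 2 < Real.cos α := by
    rw [← Real.cos_pi_div_three]
    exact Real.cos_lt_cos_of_nonneg_of_le_pi h0.le (by linarith) h1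
  have cos_eq : Real.cos α = 1 - 2 * Real.sin (α / 2) ^ 2 := by
    linarith [Real.sin_sq_eq_half_sub (α / 2), congrArg Real.cos (mul_div_cancel₀ α two_ne_zero)]
  have radius : HasDerivAt (fun a => 2 * Real.cos a - 1) (2 * -Real.sin α) α :=
    ((Real.hasDerivAt_cos α).const_mul 2).sub_const 1
  have radius_ne : 2 * Real.cos α - 1 ≠ 0 := by linarith
  have phase : HasDerivAt (fun a : ℝ => Complex.exp (a * Complex.I))
      (Complex.exp (α * Complex.I) * Complex.I) α := by
    simpa using (((hasDerivAt_id α).ofReal_comp).mul_const Complex.I).cexp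
  have log_eq := log_one_sub_two_cos_sub_one_mul_exp h0 (by linarith : α < π)
  refine ((hasDerivAt_re_dilog_comp (radius.ofReal_comp.mul phase)
    (one_sub_two_cos_sub_one_mul_exp_mem_slitPlane h0 (by linarith))
    (mul_ne_zero (Complex.ofReal_ne_zero.2 radius_ne) (Complex.exp_ne_zero _))).sub
    (((hasDerivAt_reDilog (by nlinarith) radius_ne).comp α radius).div_const 2)).congr_deriv ?_
  have log_one_sub : Real.log (1 - (2 * Real.cos α - 1)) = 2 * Real.log (2 * Real.sin (α / 2)) := by
    rw [← Real.log_rpow (by positivity), cos_eq]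
    congr 1
    norm_num
    ring
  rw [Pi.mul_apply, polar_logDeriv radius_ne, log_eq, log_one_sub]
  generalize velocity_re : 2 * -Real.sin α / (2 * Real.cos α - 1) = v
  simp only [Complex.mul_re, Complex.mul_im, Complex.add_re, Complex.add_im, Complex.ofReal_re,
    Complex.ofReal_im, Complex.I_re, Complex.I_im]
  rw [← velocity_re]
  ring

theorem re_dilog_rho_mul_exp :
    (dilog (rho * Complex.exp ((π / 4 : ℝ) * Complex.I))).re = reDilog rho / 2 + π ^ 2 / 192 := by
  have hπ := Real.pi_pos
  have const := eq_of_hasDerivAt_zero (f := fun a : ℝ =>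
    (dilog ((2 * Real.cos a - 1 : ℝ) * Complex.exp (a * Complex.I))).re -
      reDilog (2 * Real.cos a - 1) / 2 - (3 * a ^ 2 / 4 - π * a / 2))
    (show π / 4 ≤ π / 3 by linarith) (fun a ha => ?_) fun a ha => ?_
  · have radius : 2 * (√2 / 2) - 1 = rho := by rw [rho]; ring
    have radius_zero : (2 : ℝ) * (1 / 2) - 1 = 0 := by norm_num
    rw [Real.cos_pi_div_four, Real.cos_pi_div_three, radius, radius_zero, Complex.ofReal_zero,
      zero_mul, dilog_zero, reDilog_zero, Complex.zero_re] at const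
    linarith
  · have cos_lt_one : Real.cos a < 1 := by
      rw [← Real.cos_zero]
      exact Real.cos_lt_cos_of_nonneg_of_le_pi le_rfl (by linarith [ha.2]) (by linarith [ha.1])
    have real_part : ContinuousAt (fun a => reDilog (2 * Real.cos a - 1)) a :=
      (continuousAt_reDilog (by linarith)).comp (f := fun a => 2 * Real.cos a - 1) (by fun_prop)
    have curve : ContinuousAt (fun a : ℝ =>
        dilog ((2 * Real.cos a - 1 : ℝ) * Complex.exp (a * Complex.I))) a :=
      (continuousAt_dilog (one_sub_two_cos_sub_one_mul_exp_mem_slitPlane (by linarith [ha.1])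
        (by linarith [ha.2]))).comp (f := fun a : ℝ =>
          ((2 * Real.cos a - 1 : ℝ) : ℂ) * Complex.exp (a * Complex.I)) (by fun_prop)
    exact (((Complex.continuous_re.continuousAt.comp curve).sub (real_part.div_const 2)).sub
      (by fun_prop)).continuousWithinAt
  · refine ((hasDerivAt_re_dilog_two_cos_sub_one_mul_exp (by linarith [ha.1]) ha.2).sub
      (((((hasDerivAt_id a).pow 2).const_mul 3).div_const 4).sub
        (((hasDerivAt_id a).const_mul π).div_const 2))).congr_deriv ?_
    simp only [id]
    ring

/-! ### Multiple polylogarithms of weight two -/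

theorem GPL_inv_singleton {z : ℂ} (h0 : z ≠ 0) (hz : 1 - z ∈ Complex.slitPlane) {t : ℝ}
    (ht : t ∈ Icc (0 : ℝ) 1) : GPL [z⁻¹] t = Complex.log (1 - t * z) := by
  have not_all_zero : ¬ ∀ α ∈ [z⁻¹], α = 0 := by simpa using h0
  rw [GPL, if_neg not_all_zero, ← integral_div_one_sub_mul (one_sub_mul_mem_slitPlane hz ht)]
  congr 1; ext s
  rw [GPL, mul_one, ← mul_div_mul_right _ _ (neg_ne_zero.2 h0), sub_mul, mul_neg z⁻¹,
    inv_mul_cancel₀ h0]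
  congr 1 <;> ring

theorem MPL_two {z : ℂ} (h0 : z ≠ 0) (hz : 1 - z ∈ Complex.slitPlane) :
    MPL [(2, z)] = dilog z := by
  have word : mplWord 1 [(2, z)] = [0, z⁻¹] := by simp [mplWord]
  have not_all_zero : ¬ ∀ α ∈ [0, z⁻¹], α = 0 := by simpa using h0
  rw [MPL, word, GPL, if_neg not_all_zero, dilog, List.length_singleton, pow_one, neg_one_mul,
    ← intervalIntegral.integral_neg]
  refine integral_congr fun t ht => ?_
  rw [uIcc_of_le zero_le_one] at ht
  simp only [mul_one, sub_zero]
  rw [GPL_inv_singleton h0 hz ht]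
  ring

theorem MPL_one_one_eq_integral {z w : ℂ} (hz : z ≠ 0) (hw : w ≠ 0)
    (hzw : 1 - z * w ∈ Complex.slitPlane) :
    MPL [(1, z), (1, w)] = ∫ t in (0 : ℝ)..1, Complex.log (1 - t * (z * w)) / (t - z⁻¹) := by
  have word : mplWord 1 [(1, z), (1, w)] = [z⁻¹, (z * w)⁻¹] := by simp [mplWord]
  have not_all_zero : ¬ ∀ α ∈ [z⁻¹, (z * w)⁻¹], α = 0 := by simp [hz]
  rw [MPL, word, GPL, if_neg not_all_zero]
  simp only [List.length_cons, List.length_nil, zero_add, Nat.reduceAdd, even_two, Even.neg_pow,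
    one_pow, one_mul, mul_one]
  refine integral_congr fun t ht => ?_
  rw [uIcc_of_le zero_le_one] at ht
  rw [GPL_inv_singleton (mul_ne_zero hz hw) hzw ht]
  ring

theorem hasDerivAt_MPL_one_one_antideriv {z w : ℂ} {t : ℝ} (hz : z ≠ 0) (hw : w ≠ 1)
    (hu : 1 - t * (z * w) ∈ Complex.slitPlane)
    (hv : 1 - (1 - t * (z * w)) / (1 - w) ∈ Complex.slitPlane) :
    HasDerivAt (fun t : ℝ => Complex.log (1 - t * (z * w)) *
        Complex.log (1 - (1 - t * (z * w)) / (1 - w)) + dilog ((1 - t * (z * w)) / (1 - w)))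
      (Complex.log (1 - t * (z * w)) / (t - z⁻¹)) t := by
  have hw1 : 1 - w ≠ 0 := sub_ne_zero.2 hw.symm
  have u_ne := Complex.slitPlane_ne_zero hu
  have u_deriv : HasDerivAt (fun t : ℝ => 1 - (t : ℂ) * (z * w)) (-(z * w)) t := by
    simpa using ((hasDerivAt_id t).ofReal_comp.mul_const (z * w)).const_sub 1
  have v_deriv := u_deriv.div_const (1 - w)
  have one_sub_v : 1 - (1 - t * (z * w)) / (1 - w) = z * w * (t - z⁻¹) / (1 - w) := by
    field_simp
    ring
  have v_ne := Complex.slitPlane_ne_zero hv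
  rw [one_sub_v] at v_ne
  have : (t : ℂ) - z⁻¹ ≠ 0 := fun h => v_ne (by rw [h]; simp)
  have w_ne : w ≠ 0 := fun h => v_ne (by rw [h]; simp)
  refine ((u_deriv.clog_real hu).mul ((v_deriv.const_sub 1).clog_real hv)).add
    ((hasDerivAt_dilog hv (div_ne_zero u_ne hw1)).comp t v_deriv) |>.congr_deriv ?_
  have quotient_v : -(-(z * w) / (1 - w)) / (1 - (1 - t * (z * w)) / (1 - w)) =
      1 / (t - z⁻¹) := by
    rw [one_sub_v]
    field_simp
  rw [quotient_v]
  field_simp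
  ring

theorem MPL_one_one_eq_dilog {z w : ℂ} (hz : z ≠ 0) (hw0 : w ≠ 0) (hw1 : w ≠ 1)
    (hzw : 1 - z * w ∈ Complex.slitPlane)
    (hv : ∀ t ∈ Icc (0 : ℝ) 1, 1 - (1 - t * (z * w)) / (1 - w) ∈ Complex.slitPlane) :
    MPL [(1, z), (1, w)] =
      Complex.log (1 - z * w) * Complex.log (1 - (1 - z * w) / (1 - w)) +
        dilog ((1 - z * w) / (1 - w)) - dilog (1 / (1 - w)) := by
  have hu {t : ℝ} (ht : t ∈ Icc (0 : ℝ) 1) := one_sub_mul_mem_slitPlane hzw ht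
  rw [MPL_one_one_eq_integral hz hw0 hzw, integral_eq_sub_of_hasDerivAt (fun t ht => by
    rw [uIcc_of_le zero_le_one] at ht
    exact hasDerivAt_MPL_one_one_antideriv hz hw1 (hu ht) (hv t ht))]
  · simp
  · refine ContinuousOn.intervalIntegrable fun t ht => ContinuousAt.continuousWithinAt ?_
    rw [uIcc_of_le zero_le_one] at ht
    have t_ne : (t : ℂ) - z⁻¹ ≠ 0 := by
      intro h
      refine Complex.slitPlane_ne_zero (hv t ht) ?_
      rw [sub_eq_zero.1 h, inv_mul_cancel_left₀ hz, div_self (sub_ne_zero.2 hw1.symm), sub_self]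
    exact (hasDerivAt_log_one_sub_mul (hu ht)).continuousAt.div (by fun_prop) t_ne

/-! ### The eighth root of unity `θ` -/

theorem theta_eq_exp : theta = Complex.exp ((π / 4 : ℝ) * Complex.I) := by
  rw [theta]; push_cast; congr 1; ring

theorem theta_eq : theta = (√2 / 2 : ℝ) + (√2 / 2 : ℝ) * Complex.I := by
  rw [theta_eq_exp, Complex.exp_mul_I, ← Complex.ofReal_cos, ← Complex.ofReal_sin,
    Real.cos_pi_div_four, Real.sin_pi_div_four]

theorem theta_re : theta.re = √2 / 2 := by simp [theta_eq]

theorem theta_im : theta.im = √2 / 2 := by simp [theta_eq]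

theorem theta_im_ne_zero : theta.im ≠ 0 := by rw [theta_im]; positivity

theorem norm_theta : ‖theta‖ = 1 := by rw [theta_eq_exp, Complex.norm_exp_ofReal_mul_I]

theorem theta_ne_zero : theta ≠ 0 := norm_ne_zero_iff.1 (norm_theta ▸ one_ne_zero)

theorem theta_sq : theta ^ 2 = Complex.I := by
  rw [theta_eq_exp, ← Complex.exp_nat_mul]
  convert Complex.exp_pi_div_two_mul_I using 2
  push_cast
  ring

theorem sqrt_two_mul_theta : (√2 : ℝ) * theta = 1 + Complex.I := by
  have sq : ((√2 : ℝ) : ℂ) ^ 2 = 2 := by exact_mod_cast Real.sq_sqrt (zero_le_two (α := ℝ))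
  rw [theta_eq]
  push_cast
  linear_combination (1 + Complex.I) / 2 * sq

theorem imLi2_eq : imLi2 = (dilog theta).im := by
  rw [imLi2, MPL_two theta_ne_zero (one_sub_mem_slitPlane_of_im_ne_zero theta_im_ne_zero)]

theorem catalanG_eq : catalanG = (dilog Complex.I).im := by
  rw [catalanG, MPL_two Complex.I_ne_zero (one_sub_mem_slitPlane_of_im_ne_zero (by simp))]

theorem re_dilog_exp {x : ℝ} (hx : x ∈ Icc (0 : ℝ) 1) :
    (dilog (Complex.exp ((2 * π * x : ℝ) * Complex.I))).re = π ^ 2 * (x ^ 2 - x + 1 / 6) := by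
  have fourier : HasSum (fun n : ℕ =>
      (Complex.exp ((2 * π * x : ℝ) * Complex.I) ^ n / (n : ℂ) ^ 2).re) _ :=
    (hasSum_one_div_nat_pow_mul_cos (k := 1) one_ne_zero hx).congr_fun fun n => by
      rw [← Complex.exp_nat_mul, ← Complex.ofReal_natCast, ← Complex.ofReal_pow,
        Complex.div_ofReal_re, ← mul_assoc, ← Complex.ofReal_mul, Complex.exp_ofReal_mul_I_re]
      ring_nf
  have bernoulli_two_eval :
      Polynomial.eval x (Polynomial.map (algebraMap ℚ ℝ) (Polynomial.bernoulli 2)) =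
        x ^ 2 - x + 1 / 6 := by
    simp only [Polynomial.bernoulli, Finset.sum_range_succ, Finset.range_zero, Finset.sum_empty,
      Polynomial.map_add, Polynomial.map_monomial, Polynomial.eval_add, Polynomial.eval_monomial]
    simp [bernoulli_one, bernoulli_two]
    ring
  rw [(Complex.hasSum_re (hasSum_dilog (by rw [Complex.norm_exp_ofReal_mul_I]))).unique fourier,
    mul_one, bernoulli_two_eval, Nat.factorial_two]
  push_cast
  ring

theorem re_dilog_theta : (dilog theta).re = 11 * π ^ 2 / 192 := by
  have eighth : 2 * π * (1 / 8) = π / 4 := by ring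
  have value := re_dilog_exp (x := 1 / 8) ⟨by norm_num, by norm_num⟩
  rw [eighth, ← theta_eq_exp] at value
  rw [value]
  ring

theorem re_dilog_neg_theta : (dilog (-theta)).re = -13 * π ^ 2 / 192 := by
  have five_eighths : 2 * π * (5 / 8) = π / 4 + π := by ring
  have value := re_dilog_exp (x := 5 / 8) ⟨by norm_num, by norm_num⟩
  rw [five_eighths, Complex.ofReal_add, add_mul, Complex.exp_add, Complex.exp_pi_mul_I,
    mul_neg_one, ← theta_eq_exp] at value
  rw [value]
  ring

theorem im_theta_pow_sub_neg_theta_pow (n : ℕ) :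
    (theta ^ n - (-theta) ^ n).im = √2 * (ZMod.χ₈' (n : ZMod 8) : ℝ) := by
  obtain ⟨m, rfl | rfl⟩ := n.even_or_odd'
  · rw [ZMod.χ₈'_nat_eq_if_mod_eight, if_pos (Nat.mul_mod_right 2 m), (even_two_mul m).neg_pow]
    simp
  · have power : theta ^ (2 * m + 1) = Complex.I ^ (m % 4) * theta := by
      rw [pow_succ, pow_mul, theta_sq, Complex.I_pow_eq_pow_mod]
    have odd : (2 * m + 1) % 2 ≠ 0 := by omega
    have mod_eight : (2 * m + 1) % 8 = 2 * (m % 4) + 1 := by omega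
    rw [Odd.neg_pow ⟨m, rfl⟩, power, ZMod.χ₈'_nat_eq_if_mod_eight, if_neg odd, mod_eight]
    have mod_four_lt : m % 4 < 4 := Nat.mod_lt m four_pos
    interval_cases m % 4 <;> simp [theta_re, theta_im, Complex.I_pow_three, ← two_mul] <;> ring

theorem im_dilog_theta_sub : (dilog theta - dilog (-theta)).im = √2 * LConst := by
  have series := Complex.hasSum_im ((hasSum_dilog norm_theta.le).sub
    (hasSum_dilog (z := -theta) (by rw [norm_neg, norm_theta])))
  rw [LConst, ← tsum_mul_left, ← series.tsum_eq]
  congr 1; ext n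
  rw [← sub_div, ← Complex.ofReal_natCast, ← Complex.ofReal_pow, Complex.div_ofReal_im,
    im_theta_pow_sub_neg_theta_pow]
  ring

theorem imLi2_sub_catalanG : imLi2 - catalanG / 4 = √2 * LConst / 2 := by
  have duplication := congrArg Complex.im (dilog_add_dilog_neg norm_theta.le)
  have difference := im_dilog_theta_sub
  rw [theta_sq, ← Complex.ofReal_ofNat, Complex.div_ofReal_im, Complex.add_im] at duplication
  rw [Complex.sub_im] at difference
  rw [imLi2_eq, catalanG_eq]
  linarith

theorem re_dilog_rho_inv_mul_theta : (dilog ((rho⁻¹ : ℝ) * theta)).re =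
    7 * π ^ 2 / 64 - reDilog rho / 2 - Real.log (1 + √2) ^ 2 / 2 := by
  have inversion := re_dilog_mul_add_re_dilog_inv_mul norm_theta theta_im_ne_zero rho_pos
  have on_curve := re_dilog_rho_mul_exp
  rw [← theta_eq_exp] at on_curve
  rw [on_curve, re_dilog_theta] at inversion
  rw [log_one_add_sqrt_two]
  linarith

theorem log_two_mul_sin_pi_div_eight :
    Real.log (2 * Real.sin (π / 8)) = Real.log 2 / 4 - Real.log (1 + √2) / 2 := by
  have sq : √(2 : ℝ) ^ 2 = 2 := Real.sq_sqrt zero_le_two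
  have product : 2 - √2 = √2 * rho := by rw [rho]; linarith
  rw [Real.sin_pi_div_eight, mul_div_cancel₀ _ two_ne_zero, product,
    Real.log_sqrt (mul_nonneg (Real.sqrt_nonneg 2) rho_pos.le),
    Real.log_mul (by positivity) rho_pos.ne', log_sqrt_two, log_one_add_sqrt_two]
  ring

theorem log_two_mul_sin_three_pi_div_eight :
    Real.log (2 * Real.sin (3 * π / 8)) = Real.log 2 / 4 + Real.log (1 + √2) / 2 := by
  have complement : 3 * π / 8 = π / 2 - π / 8 := by ring
  have sq : √(2 : ℝ) ^ 2 = 2 := Real.sq_sqrt zero_le_two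
  have product : 2 + √2 = √2 * (1 + √2) := by linarith
  rw [complement, Real.sin_pi_div_two_sub, Real.cos_pi_div_eight, mul_div_cancel₀ _ two_ne_zero,
    product, Real.log_sqrt (by positivity), Real.log_mul (by positivity) (by positivity),
    log_sqrt_two]
  ring

theorem sin_pi_div_eight_pos : 0 < Real.sin (π / 8) :=
  Real.sin_pos_of_pos_of_lt_pi (by positivity) (by linarith [Real.pi_pos])

theorem one_sub_theta_eq : 1 - theta =
    (2 * Real.sin (π / 8) : ℝ) * Complex.exp ((-(3 * π / 8) : ℝ) * Complex.I) := by
  rw [theta_eq_exp, one_sub_exp_mul_I]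
  ring_nf

theorem one_div_one_sub_theta_eq : 1 / (1 - theta) =
    ((2 * Real.sin (π / 8))⁻¹ : ℝ) * Complex.exp ((3 * π / 8 : ℝ) * Complex.I) := by
  rw [one_sub_theta_eq, Complex.ofReal_neg, neg_mul, Complex.exp_neg, one_div, mul_inv, inv_inv,
    Complex.ofReal_inv]

theorem one_div_one_sub_theta_re : (1 / (1 - theta)).re = 1 / 2 := by
  have complement : 3 * π / 8 = π / 2 - π / 8 := by ring
  have sin_ne := sin_pi_div_eight_pos.ne'
  rw [one_div_one_sub_theta_eq, Complex.re_ofReal_mul, Complex.exp_ofReal_mul_I_re, complement,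
    Real.cos_pi_div_two_sub]
  field_simp

theorem one_div_one_sub_theta_im_pos : 0 < (1 / (1 - theta)).im := by
  have sin_pos := sin_pi_div_eight_pos
  rw [one_div_one_sub_theta_eq, Complex.im_ofReal_mul, Complex.exp_ofReal_mul_I_im]
  have := Real.sin_pos_of_pos_of_lt_pi (x := 3 * π / 8) (by positivity) (by linarith [Real.pi_pos])
  positivity

theorem log_one_div_one_sub_theta : Complex.log (1 / (1 - theta)) =
    (Real.log (1 + √2) / 2 - Real.log 2 / 4 : ℝ) + (3 * π / 8 : ℝ) * Complex.I := by
  have hπ := Real.pi_pos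
  have sin_pos := sin_pi_div_eight_pos
  rw [one_div_one_sub_theta_eq, log_ofReal_mul_exp_mul_I (by positivity)
    ⟨by linarith, by linarith⟩, Real.log_inv, log_two_mul_sin_pi_div_eight, neg_sub]

theorem log_one_sub_I_mul_theta : Complex.log (1 - Complex.I * theta) =
    (Real.log 2 / 4 + Real.log (1 + √2) / 2 : ℝ) - (π / 8 : ℝ) * Complex.I := by
  have hπ := Real.pi_pos
  have polar : Complex.I * theta = Complex.exp ((3 * π / 4 : ℝ) * Complex.I) := by
    have cube : Complex.I * theta = theta ^ 3 := by rw [← theta_sq, ← pow_succ]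
    rw [cube, theta_eq_exp, ← Complex.exp_nat_mul]
    congr 1
    push_cast
    ring
  have half_angle : 3 * π / 4 / 2 = 3 * π / 8 := by ring
  rw [polar, log_one_sub_exp_mul_I (by positivity) (by linarith), half_angle,
    log_two_mul_sin_three_pi_div_eight]
  push_cast
  ring

theorem one_sub_theta_ne_zero : 1 - theta ≠ 0 := Complex.slitPlane_ne_zero
  (one_sub_mem_slitPlane_of_im_ne_zero theta_im_ne_zero)

theorem ofReal_rho_inv : ((rho⁻¹ : ℝ) : ℂ) = 1 + (√2 : ℝ) := by
  rw [inv_eq_of_mul_eq_one_right (b := 1 + √2)]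
  · norm_cast
  · linear_combination rho * sqrt_two_eq + rho_sq

theorem one_sub_I_mul_theta_div :
    (1 - Complex.I * theta) / (1 - theta) = (rho⁻¹ : ℝ) * theta := by
  rw [div_eq_iff one_sub_theta_ne_zero, ofReal_rho_inv]
  linear_combination (theta - 1) * sqrt_two_mul_theta + theta_sq

theorem one_sub_rho_inv_mul_theta_eq :
    1 - (rho⁻¹ : ℝ) * theta = -((√2 : ℝ) * (1 / (1 - theta))) := by
  have sq : ((√2 : ℝ) : ℂ) ^ 2 = 2 := by exact_mod_cast Real.sq_sqrt (zero_le_two (α := ℝ))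
  rw [← neg_mul, mul_one_div, eq_div_iff one_sub_theta_ne_zero, ofReal_rho_inv]
  linear_combination (-1 - (√2 : ℝ)) * sqrt_two_mul_theta + theta * sq + (1 + (√2 : ℝ)) * theta_sq

theorem log_one_sub_rho_inv_mul_theta : Complex.log (1 - (rho⁻¹ : ℝ) * theta) =
    (Real.log 2 / 4 + Real.log (1 + √2) / 2 : ℝ) - (5 * π / 8 : ℝ) * Complex.I := by
  have hπ := Real.pi_pos
  have sin_pos := sin_pi_div_eight_pos
  have opposite : Complex.exp ((-(5 * π / 8) : ℝ) * Complex.I) =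
      -Complex.exp ((3 * π / 8 : ℝ) * Complex.I) := by
    have shift : -(5 * π / 8) = 3 * π / 8 - π := by ring
    rw [shift, Complex.ofReal_sub, sub_mul, Complex.exp_sub, Complex.exp_pi_mul_I, div_neg, div_one]
  have polar : 1 - (rho⁻¹ : ℝ) * theta = ((√2 / (2 * Real.sin (π / 8)) : ℝ) : ℂ) *
      Complex.exp ((-(5 * π / 8) : ℝ) * Complex.I) := by
    rw [one_sub_rho_inv_mul_theta_eq, one_div_one_sub_theta_eq, opposite]
    push_cast
    ring
  rw [polar, log_ofReal_mul_exp_mul_I (by positivity) ⟨by linarith, by linarith⟩,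
    Real.log_div (by positivity) (by positivity), log_sqrt_two, log_two_mul_sin_pi_div_eight]
  push_cast
  ring

theorem MPL_I_theta_eq : MPL [(1, Complex.I), (1, theta)] =
    Complex.log (1 - Complex.I * theta) * Complex.log (1 - (rho⁻¹ : ℝ) * theta) +
      dilog ((rho⁻¹ : ℝ) * theta) - dilog (1 / (1 - theta)) := by
  have hzw : 1 - Complex.I * theta ∈ Complex.slitPlane :=
    one_sub_mem_slitPlane_of_im_ne_zero (by simp [theta_re])
  rw [MPL_one_one_eq_dilog Complex.I_ne_zero theta_ne_zero
    (sub_ne_zero.1 one_sub_theta_ne_zero).symm hzw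
    fun t ht => one_sub_mem_slitPlane_of_im_ne_zero (ne_of_gt ?_), one_sub_I_mul_theta_div]
  have segment : (1 - t * (Complex.I * theta)) / (1 - theta) =
      ((1 - t : ℝ) : ℂ) * (1 / (1 - theta)) + (t : ℝ) * ((rho⁻¹ : ℝ) * theta) := by
    rw [← one_sub_I_mul_theta_div]
    push_cast
    ring
  have im_pos : 0 < ((rho⁻¹ : ℝ) * theta).im := by
    have := rho_pos
    rw [Complex.im_ofReal_mul, theta_im]
    positivity
  rw [segment, Complex.add_im, Complex.im_ofReal_mul, Complex.im_ofReal_mul]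
  rcases ht.1.eq_or_lt with rfl | ht0
  · simpa using one_div_one_sub_theta_im_pos
  · exact add_pos_of_nonneg_of_pos
      (mul_nonneg (sub_nonneg.2 ht.2) one_div_one_sub_theta_im_pos.le) (mul_pos ht0 im_pos)

theorem reLi11_eq : reLi11 = 3 * Real.log 2 ^ 2 / 32 + Real.log 2 * Real.log (1 + √2) / 8 -
    Real.log (1 + √2) ^ 2 / 8 + 7 * π ^ 2 / 384 - reDilog rho / 2 := by
  have norm_sq : ‖Complex.log (1 / (1 - theta))‖ ^ 2 =
      (Real.log (1 + √2) / 2 - Real.log 2 / 4) ^ 2 + (3 * π / 8) ^ 2 := by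
    rw [log_one_div_one_sub_theta, ← Complex.normSq_eq_norm_sq, Complex.normSq_add_mul_I]
  rw [reLi11, MPL_I_theta_eq, Complex.sub_re, Complex.add_re, re_dilog_rho_inv_mul_theta,
    re_dilog_of_re_eq_half one_div_one_sub_theta_re, norm_sq, log_one_sub_I_mul_theta,
    log_one_sub_rho_inv_mul_theta]
  simp only [Complex.mul_re, Complex.sub_re, Complex.sub_im, Complex.ofReal_re, Complex.ofReal_im,
    Complex.mul_im, Complex.I_re, Complex.I_im]
  ring

/-! ### Evaluation of the integrals -/

/-- The Möbius map `y ↦ (√2 - y) / (√2 + y)`, which turns `dy / (2 - y²)` into a multiple of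
`ds / s`. -/
noncomputable def moebius (y : ℝ) : ℝ := (√2 - y) / (√2 + y)

theorem moebius_zero : moebius 0 = 1 := by simp [moebius]

theorem moebius_one : moebius 1 = rho ^ 2 := by
  rw [moebius, sqrt_two_eq, div_eq_iff (by linarith [rho_pos])]
  linear_combination (-rho) * rho_sq

theorem moebius_mem_Ioo {y : ℝ} (hy : y ∈ Ioo (0 : ℝ) 1) : moebius y ∈ Ioo (rho ^ 2) 1 := by
  have hρ := rho_pos
  have sum_pos : 0 < √2 + y := by linarith [hy.1, Real.sqrt_nonneg 2]
  rw [moebius, mem_Ioo, div_lt_one sum_pos, lt_div_iff₀ sum_pos, sqrt_two_eq, rho_sq]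
  refine ⟨?_, by linarith [hy.1]⟩
  nlinarith [mul_pos hρ (sub_pos.2 hy.2), rho_sq]

theorem hasDerivAt_moebius {y : ℝ} (hy : y ∈ Icc (0 : ℝ) 1) :
    HasDerivAt moebius (-(2 * √2) * quadWeight y * moebius y) y := by
  have sum_pos : 0 < √2 + y := by linarith [hy.1, Real.sqrt_pos.2 zero_lt_two]
  have sq : √(2 : ℝ) ^ 2 = 2 := Real.sq_sqrt zero_le_two
  have := two_sub_sq_pos hy
  refine (((hasDerivAt_id y).const_sub √2).div ((hasDerivAt_id y).const_add √2)
    sum_pos.ne').congr_deriv ?_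
  simp only [quadWeight, moebius, id]
  field_simp
  linear_combination 2 * √2 * sq

theorem pairing_quadWeight_one : pairing quadWeight 1 = Real.log (1 + √2) / √2 := by
  have sqrt_ne : √(2 : ℝ) ≠ 0 := by positivity
  have moebius_ne {y : ℝ} (hy : y ∈ Icc (0 : ℝ) 1) : moebius y ≠ 0 := by
    have := Real.one_lt_sqrt_two
    exact (div_pos (by linarith [hy.2]) (by linarith [hy.1])).ne'
  have ftc := integral_eq_sub_of_hasDerivAt (a := 0) (b := 1)
    (f := fun y => Real.log (moebius y)) (f' := fun y => -(2 * √2) * quadWeight y)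
    (fun y hy => by
      rw [uIcc_of_le zero_le_one] at hy
      refine ((hasDerivAt_moebius hy).log (moebius_ne hy)).congr_deriv ?_
      have := moebius_ne hy
      field_simp)
    (continuousOn_quadWeight.intervalIntegrable.const_mul _)
  rw [intervalIntegral.integral_const_mul, moebius_zero, moebius_one, Real.log_pow,
    Real.log_one] at ftc
  simp only [pairing, Pi.one_apply, mul_one]
  rw [log_one_add_sqrt_two, eq_div_iff sqrt_ne]
  push_cast at ftc
  linarith

theorem pairing_quadWeight_log : pairing quadWeight Real.log = -(reChi (√2 / 2) / √2) := by
  have sqrt_pos : 0 < √(2 : ℝ) := by positivity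
  have sq : √(2 : ℝ) ^ 2 = 2 := Real.sq_sqrt zero_le_two
  have sqrt_lt : √2 / 2 < 1 := by nlinarith
  have chi := integral_log_mul_div_one_sub_sq (z := (√2 / 2 : ℝ))
    (one_sub_ofReal_mem_slitPlane sqrt_lt)
    (by simpa using one_sub_ofReal_mem_slitPlane (x := -(√2 / 2)) (by linarith))
  have integrand : ∫ t in (0 : ℝ)..1, (Real.log t : ℂ) * (((√2 / 2 : ℝ) : ℂ) /
      (1 - ((t : ℂ) * (√2 / 2 : ℝ)) ^ 2)) = ((√2 * pairing quadWeight Real.log : ℝ) : ℂ) := by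
    rw [pairing, ← intervalIntegral.integral_const_mul, ← intervalIntegral.integral_ofReal]
    refine integral_congr fun y hy => ?_
    rw [uIcc_of_le zero_le_one] at hy
    have := two_sub_sq_pos hy
    norm_cast
    have denominator : 1 - (y * (√2 / 2)) ^ 2 = (2 - y ^ 2) / 2 := by
      linear_combination (-y ^ 2 / 4) * sq
    rw [denominator, quadWeight]
    field_simp
  rw [integrand] at chi
  have real := congrArg Complex.re chi
  simp only [legendreChi, Complex.neg_re, Complex.div_ofNat_re, Complex.sub_re,
    ← Complex.ofReal_neg, Complex.ofReal_re] at real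
  rw [← neg_div, eq_div_iff sqrt_pos.ne', mul_comm, real]
  rfl

theorem log_one_sub_sq_eq_moebius {y : ℝ} (hy : y ∈ Ioo (0 : ℝ) 1) :
    Real.log (1 - y ^ 2) = Real.log (moebius y) + 2 * Real.log (1 + √2) +
      Real.log (1 - rho ^ 2 / moebius y) + Real.log (1 - rho ^ 2 * moebius y) -
      2 * Real.log (1 + moebius y) := by
  obtain ⟨hy0, hy1⟩ := hy
  have hρ := rho_pos
  have plus : 0 < √2 + y := by linarith [sqrt_two_eq]
  have minus : 0 < √2 - y := by linarith [sqrt_two_eq]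
  have one_add : 1 + moebius y = 2 * √2 / (√2 + y) := by
    rw [moebius]; field_simp; ring
  have one_sub_div : 1 - rho ^ 2 / moebius y = 2 * √2 * rho * (1 - y) / (√2 - y) := by
    rw [moebius, sqrt_two_eq] at *
    field_simp
    linear_combination (y - rho - 1) * rho_sq
  have one_sub_mul : 1 - rho ^ 2 * moebius y = 2 * √2 * rho * (1 + y) / (√2 + y) := by
    rw [moebius, sqrt_two_eq] at *
    field_simp
    linear_combination (-y - rho - 1) * rho_sq
  have scale : 0 < 2 * √(2 : ℝ) := by positivity
  rw [one_add, one_sub_div, one_sub_mul, log_one_add_sqrt_two, moebius,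
    Real.log_div minus.ne' plus.ne', Real.log_div (by positivity) plus.ne',
    Real.log_div (mul_pos (by positivity) (by linarith)).ne' minus.ne',
    Real.log_div (by positivity) plus.ne', Real.log_mul (by positivity) (by linarith),
    Real.log_mul (x := 2 * √2 * rho) (by positivity) (by linarith),
    Real.log_mul scale.ne' hρ.ne',
    show 1 - y ^ 2 = (1 - y) * (1 + y) by ring, Real.log_mul (by linarith) (by linarith)]
  ring

/-- An antiderivative in `s = (√2 - y) / (√2 + y)` of `log (1 - y²) / s`. -/
noncomputable def moebiusPrimitive (s : ℝ) : ℝ :=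
  Real.log s ^ 2 / 2 + 2 * Real.log (1 + √2) * Real.log s + reDilog (rho ^ 2 / s) -
    reDilog (rho ^ 2 * s) + 2 * reDilog (-s)

theorem hasDerivAt_moebiusPrimitive {s : ℝ} (hs : s ∈ Ioo (rho ^ 2) 1) :
    HasDerivAt moebiusPrimitive ((Real.log s + 2 * Real.log (1 + √2) + Real.log (1 - rho ^ 2 / s) +
      Real.log (1 - rho ^ 2 * s) - 2 * Real.log (1 + s)) / s) s := by
  have hρ := rho_pos
  have hs0 : 0 < s := (pow_pos hρ 2).trans hs.1
  have mul_lt : rho ^ 2 * s < 1 := by nlinarith [hs.1, hs.2]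
  have hlog := Real.hasDerivAt_log hs0.ne'
  have quotient := (hasDerivAt_reDilog ((div_lt_one hs0).2 hs.1) (by positivity)).comp s
    ((hasDerivAt_const s (rho ^ 2)).div (hasDerivAt_id s) hs0.ne')
  have product := (hasDerivAt_reDilog mul_lt (by positivity)).comp s
    ((hasDerivAt_id s).const_mul (rho ^ 2))
  have negative := (hasDerivAt_reDilog (x := -s) (by linarith) (by linarith)).comp s
    (hasDerivAt_neg s)
  refine ((((((hlog.pow 2).div_const 2).add (hlog.const_mul (2 * Real.log (1 + √2)))).add
    quotient).sub product).add (negative.const_mul 2)).congr_deriv ?_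
  simp only [sub_neg_eq_add]
  field_simp
  ring

theorem continuousOn_moebiusPrimitive : ContinuousOn moebiusPrimitive (Icc (rho ^ 2) 1) := by
  have hρ := pow_pos rho_pos 2
  have pos {s : ℝ} (hs : s ∈ Icc (rho ^ 2) 1) : 0 < s := hρ.trans_le hs.1
  have hlog : ContinuousOn Real.log (Icc (rho ^ 2) 1) :=
    Real.continuousOn_log.mono fun s hs => (pos hs).ne'
  have quotient : ContinuousOn (fun s => reDilog (rho ^ 2 / s)) (Icc (rho ^ 2) 1) :=
    continuousOn_reDilog.comp (continuousOn_const.div continuousOn_id fun s hs => (pos hs).ne')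
      fun s hs => ⟨(div_pos hρ (pos hs)).le, (div_le_one (pos hs)).2 hs.1⟩
  have product : ContinuousOn (fun s => reDilog (rho ^ 2 * s)) (Icc (rho ^ 2) 1) :=
    continuousOn_reDilog.comp (by fun_prop) fun s hs =>
      ⟨(mul_pos hρ (pos hs)).le, by nlinarith [hs.1, hs.2]⟩
  have negative : ContinuousOn (fun s => reDilog (-s)) (Icc (rho ^ 2) 1) := fun s hs =>
    ((continuousAt_reDilog (by linarith [pos hs])).comp continuousAt_neg).continuousWithinAt
  exact (((((hlog.pow 2).div_const 2).add (hlog.const_mul _)).add quotient).sub product).add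
    (negative.const_mul 2)

theorem moebiusPrimitive_one_sub : moebiusPrimitive 1 - moebiusPrimitive (rho ^ 2) =
    4 * Real.log (1 + √2) ^ 2 - 5 * π ^ 2 / 6 + 8 * reDilog rho := by
  have hρ := rho_pos
  have duplication := reDilog_add_reDilog_neg (x := rho ^ 2)
    (by rw [abs_of_pos (by positivity)]; nlinarith [rho_lt_half])
  rw [moebiusPrimitive, moebiusPrimitive, div_self (by positivity), reDilog_one, Real.log_one,
    Real.log_pow, ← pow_two, reDilog_neg_one, log_one_add_sqrt_two] at *
  have square := reDilog_rho_sq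
  rw [log_one_add_sqrt_two] at square
  push_cast
  rw [mul_one, div_one]
  linear_combination (-2) * duplication + 2 * square

theorem pairing_quadWeight_log_one_sub_sq :
    pairing quadWeight (fun y => Real.log (1 - y ^ 2)) =
      √2 / 4 * (4 * Real.log (1 + √2) ^ 2 - 5 * π ^ 2 / 6 + 8 * reDilog rho) := by
  have sq : √(2 : ℝ) ^ 2 = 2 := Real.sq_sqrt zero_le_two
  have hmaps : MapsTo moebius (Icc 0 1) (Icc (rho ^ 2) 1) := fun y hy => by
    rcases eq_endpoints_or_mem_Ioo_of_mem_Icc hy with rfl | rfl | hy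
    · rw [moebius_zero]; exact ⟨by nlinarith [rho_pos, rho_lt_half], le_rfl⟩
    · rw [moebius_one]; exact ⟨le_rfl, by nlinarith [rho_pos, rho_lt_half]⟩
    · exact Ioo_subset_Icc_self (moebius_mem_Ioo hy)
  have ftc := integral_eq_sub_of_hasDerivAt_of_le zero_le_one
    (f := fun y => moebiusPrimitive (moebius y))
    (f' := fun y => -(2 * √2) * (quadWeight y * Real.log (1 - y ^ 2)))
    (continuousOn_moebiusPrimitive.comp
      (fun y hy => (hasDerivAt_moebius hy).continuousAt.continuousWithinAt) hmaps)
    (fun y hy => by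
      have mem := moebius_mem_Ioo hy
      have moebius_ne : moebius y ≠ 0 := ((pow_pos rho_pos 2).trans mem.1).ne'
      refine ((hasDerivAt_moebiusPrimitive mem).comp y
        (hasDerivAt_moebius (Ioo_subset_Icc_self hy))).congr_deriv ?_
      rw [log_one_sub_sq_eq_moebius hy]
      field_simp)
    ((intervalIntegrable_log_one_sub_sq.continuousOn_mul continuousOn_quadWeight).const_mul _)
  rw [intervalIntegral.integral_const_mul, moebius_zero, moebius_one] at ftc
  rw [pairing]
  linear_combination (-√2 / 4) * ftc + √2 / 4 * moebiusPrimitive_one_sub -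
    (∫ y in (0 : ℝ)..1, quadWeight y * Real.log (1 - y ^ 2)) / 2 * sq

theorem theta_div_one_sub_theta_mul_sq (t : ℝ) : theta / (1 - (t * theta) ^ 2) =
    (quarticWeightSub t + quarticWeightAdd t * Complex.I) / (√2 : ℝ) := by
  have I_sq := Complex.I_sq
  have denominator : (1 - t ^ 2 * Complex.I) * (1 + t ^ 2 * Complex.I) = ((1 + t ^ 4 : ℝ) : ℂ) := by
    push_cast; linear_combination (-(t : ℂ) ^ 4) * I_sq
  have quartic_ne : ((1 + t ^ 4 : ℝ) : ℂ) ≠ 0 := Complex.ofReal_ne_zero.2 (by positivity)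
  have linear_ne : 1 - t ^ 2 * Complex.I ≠ 0 := left_ne_zero_of_mul (denominator ▸ quartic_ne)
  have sqrt_ne : ((√2 : ℝ) : ℂ) ≠ 0 := Complex.ofReal_ne_zero.2 (by positivity)
  rw [mul_pow, theta_sq, quarticWeightSub, quarticWeightAdd, Complex.ofReal_div,
    Complex.ofReal_div, div_eq_div_iff linear_ne sqrt_ne]
  field_simp
  rw [mul_comm theta, sqrt_two_mul_theta, ← denominator]
  push_cast
  linear_combination (1 - t ^ 2 * Complex.I) * t ^ 2 * I_sq

theorem one_add_theta_mem_slitPlane : 1 + theta ∈ Complex.slitPlane :=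
  Or.inr (by simpa using theta_im_ne_zero)

theorem pairing_quarticWeight_log_complex :
    (pairing quarticWeightSub Real.log + pairing quarticWeightAdd Real.log * Complex.I : ℂ) =
      -((√2 : ℝ) * legendreChi theta) := by
  have sqrt_ne : ((√2 : ℝ) : ℂ) ≠ 0 := Complex.ofReal_ne_zero.2 (by positivity)
  have log_int : IntervalIntegrable Real.log volume 0 1 := intervalIntegrable_log'
  have ofReal_int {w : ℝ → ℝ} (hw : Continuous w) :
      IntervalIntegrable (fun y => ((w y * Real.log y : ℝ) : ℂ)) volume 0 1 :=
    have real_int := log_int.continuousOn_mul hw.continuousOn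
    ⟨real_int.1.ofReal, real_int.2.ofReal⟩
  rw [← mul_neg, ← integral_log_mul_div_one_sub_sq
      (one_sub_mem_slitPlane_of_im_ne_zero theta_im_ne_zero)
      one_add_theta_mem_slitPlane,
    ← intervalIntegral.integral_const_mul, pairing, pairing, ← intervalIntegral.integral_ofReal,
    ← intervalIntegral.integral_ofReal, ← intervalIntegral.integral_mul_const,
    ← intervalIntegral.integral_add (ofReal_int continuous_quarticWeightSub)
      ((ofReal_int continuous_quarticWeightAdd).mul_const _)]
  congr 1; ext t
  rw [theta_div_one_sub_theta_mul_sq]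
  push_cast
  field_simp

theorem pairing_quarticWeightSub_log :
    pairing quarticWeightSub Real.log = -(√2 * π ^ 2 / 16) := by
  have real := congrArg Complex.re pairing_quarticWeight_log_complex
  simp only [legendreChi, Complex.add_re, Complex.neg_re, Complex.re_ofReal_mul,
    Complex.div_ofNat_re, Complex.sub_re, Complex.ofReal_re, re_dilog_theta,
    re_dilog_neg_theta, Complex.I_re, mul_zero, add_zero] at real
  rw [real]
  ring

theorem pairing_quarticWeightAdd_log : pairing quarticWeightAdd Real.log = -LConst := by
  have imaginary := congrArg Complex.im pairing_quarticWeight_log_complex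
  have sq : √(2 : ℝ) ^ 2 = 2 := Real.sq_sqrt zero_le_two
  simp only [legendreChi, Complex.add_im, Complex.neg_im, Complex.im_ofReal_mul,
    Complex.div_ofNat_im, im_dilog_theta_sub, Complex.ofReal_im, Complex.I_im, mul_one,
    zero_add] at imaginary
  rw [imaginary]
  linear_combination (-LConst / 2) * sq

theorem pairing_quarticWeightSub_comp (g : ℝ → ℝ) :
    pairing quarticWeightSub (fun y => g (2 * y / (1 + y ^ 2))) = pairing quadWeight g := by
  have substitution := integral_comp_mul_deriv_of_deriv_nonneg (a := 0) (b := 1)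
    (f := fun y : ℝ => 2 * y / (1 + y ^ 2)) (f' := fun y => 2 * (1 - y ^ 2) / (1 + y ^ 2) ^ 2)
    (g := fun x => quadWeight x * g x)
    (Continuous.div (by fun_prop) (by fun_prop) fun y => by positivity).continuousOn
    (fun y _ => by
      refine (((hasDerivAt_id y).const_mul 2).div ((hasDerivAt_pow 2 y).const_add 1)
        (by positivity)).congr_deriv ?_
      simp only [id]
      ring)
    (fun y hy => by
      rw [min_eq_left zero_le_one, max_eq_right zero_le_one] at hy
      have : 0 ≤ 1 - y ^ 2 := by nlinarith [hy.1, hy.2]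
      positivity)
  simp only [mul_zero, zero_div, mul_one, one_pow, one_add_one_eq_two,
    div_self (two_ne_zero (α := ℝ))] at substitution
  rw [pairing, pairing, ← substitution]
  congr 1; ext y
  have denominator : 2 - (2 * y / (1 + y ^ 2)) ^ 2 = 2 * (1 + y ^ 4) / (1 + y ^ 2) ^ 2 := by
    field_simp; ring
  simp only [Function.comp, quadWeight, quarticWeightSub, denominator]
  field_simp

theorem pairing_quarticWeightSub_one : pairing quarticWeightSub 1 = Real.log (1 + √2) / √2 :=
  (pairing_quarticWeightSub_comp 1).trans pairing_quadWeight_one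

theorem pairing_quarticWeightSub_log_one_sub_sq :
    pairing quarticWeightSub (fun y => Real.log (1 - y ^ 2)) =
      pairing quadWeight (fun y => Real.log (1 - y ^ 2)) / 2 - pairing quadWeight Real.log +
        pairing quarticWeightSub Real.log + Real.log 2 * Real.log (1 + √2) / √2 := by
  have one_int : IntervalIntegrable (1 : ℝ → ℝ) volume 0 1 := intervalIntegrable_const
  have log_int : IntervalIntegrable Real.log volume 0 1 := intervalIntegrable_log'
  have weight := continuous_quarticWeightSub.continuousOn (s := uIcc 0 1)
  have comp := pairing_quarticWeightSub_comp fun x => 1 / 2 * Real.log (1 - x ^ 2) - Real.log x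
  have transformed : pairing quarticWeightSub (fun y => 1 / 2 *
        Real.log (1 - (2 * y / (1 + y ^ 2)) ^ 2) - Real.log (2 * y / (1 + y ^ 2))) =
      pairing quarticWeightSub fun y =>
        Real.log (1 - y ^ 2) - Real.log y - Real.log 2 * (1 : ℝ → ℝ) y := by
    refine integral_congr_Ioo_of_le zero_le_one fun y hy => ?_
    have y_ne : y ≠ 0 := hy.1.ne'
    have sub_ne : 1 - y ^ 2 ≠ 0 := by nlinarith [hy.1, hy.2]
    have add_ne : 1 + y ^ 2 ≠ 0 := by positivity
    have square : 1 - (2 * y / (1 + y ^ 2)) ^ 2 = ((1 - y ^ 2) / (1 + y ^ 2)) ^ 2 := by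
      field_simp; ring
    simp only [square, Real.log_pow, Real.log_div sub_ne add_ne, Pi.one_apply,
      Real.log_div (mul_ne_zero two_ne_zero y_ne) add_ne, Real.log_mul two_ne_zero y_ne]
    push_cast
    ring
  rw [transformed, pairing_sub weight (intervalIntegrable_log_one_sub_sq.sub log_int)
      (one_int.const_mul _), pairing_sub weight intervalIntegrable_log_one_sub_sq log_int,
    pairing_const_mul, pairing_quarticWeightSub_one, pairing_sub continuousOn_quadWeight
      (intervalIntegrable_log_one_sub_sq.const_mul _) log_int, pairing_const_mul] at comp
  linear_combination comp

/-- The primitive `arctan (√2 y / (1 - y²))` of `√2 (1 + y²) / (1 + y⁴)`, written so as to be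
continuous at `y = 1`. -/
noncomputable def quarticArctan (y : ℝ) : ℝ := Real.arctan (√2 * y - 1) + Real.arctan (√2 * y + 1)

theorem quarticArctan_zero : quarticArctan 0 = 0 := by
  simp [quarticArctan, Real.arctan_neg]

theorem quarticArctan_one : quarticArctan 1 = π / 2 := by
  have inverse : √2 + 1 = (√2 - 1)⁻¹ := eq_inv_of_mul_eq_one_left
    (by linear_combination Real.sq_sqrt (zero_le_two (α := ℝ)))
  rw [quarticArctan, mul_one, inverse,
    Real.arctan_inv_of_pos (sub_pos.2 Real.one_lt_sqrt_two), add_sub_cancel]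

theorem tan_quarticArctan {y : ℝ} (hy : y ^ 2 < 1) :
    Real.tan (quarticArctan y) = √2 * y / (1 - y ^ 2) := by
  have sq : √(2 : ℝ) ^ 2 = 2 := Real.sq_sqrt zero_le_two
  have product : (√2 * y - 1) * (√2 * y + 1) = 2 * y ^ 2 - 1 := by linear_combination y ^ 2 * sq
  have sum : √2 * y - 1 + (√2 * y + 1) = 2 * (√2 * y) := by ring
  rw [quarticArctan, Real.arctan_add (by linarith), Real.tan_arctan, product, sum,
    show 1 - (2 * y ^ 2 - 1) = 2 * (1 - y ^ 2) by ring, mul_div_mul_left _ _ two_ne_zero]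

theorem hasDerivAt_quarticArctan (y : ℝ) :
    HasDerivAt quarticArctan (√2 * quarticWeightAdd y) y := by
  have sq : √(2 : ℝ) ^ 2 = 2 := Real.sq_sqrt zero_le_two
  have line : HasDerivAt (fun y : ℝ => √2 * y) √2 y := by
    simpa using (hasDerivAt_id y).const_mul √2
  refine ((line.sub_const 1).arctan.add (line.add_const 1).arctan).congr_deriv ?_
  have minus_ne : 1 + (√2 * y - 1) ^ 2 ≠ 0 := by positivity
  have plus_ne : 1 + (√2 * y + 1) ^ 2 ≠ 0 := by positivity
  have product : (1 + (√2 * y - 1) ^ 2) * (1 + (√2 * y + 1) ^ 2) = 4 * (1 + y ^ 4) := by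
    linear_combination y ^ 4 * (√2 ^ 2 + 2) * sq
  have sum : 1 + (√2 * y + 1) ^ 2 + (1 + (√2 * y - 1) ^ 2) = 4 * (1 + y ^ 2) := by
    linear_combination 2 * y ^ 2 * sq
  rw [← add_mul, div_add_div _ _ minus_ne plus_ne, one_mul, mul_one, sum, product,
    mul_div_mul_left _ _ four_ne_zero, quarticWeightAdd, mul_comm]

theorem pairing_quarticWeightAdd_comp (g : ℝ → ℝ) :
    √2 * pairing quarticWeightAdd (fun y => g (quarticArctan y)) =
      ∫ x in (0 : ℝ)..π / 2, g x := by
  rw [← quarticArctan_zero, ← quarticArctan_one, ← integral_comp_mul_deriv_of_deriv_nonneg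
    (fun y _ => (hasDerivAt_quarticArctan y).continuousAt.continuousWithinAt)
    (fun y _ => hasDerivAt_quarticArctan y)
    (fun y _ => mul_nonneg (Real.sqrt_nonneg 2)
      (div_nonneg (by positivity : 0 ≤ 1 + y ^ 2) (by positivity))),
    pairing, ← intervalIntegral.integral_const_mul]
  congr 1; ext y
  simp only [Function.comp]
  ring

theorem integral_log_tan_zero_pi_div_two : ∫ x in (0 : ℝ)..π / 2, Real.log (Real.tan x) = 0 := by
  have hπ := Real.pi_pos
  have split : ∫ x in (0 : ℝ)..π / 2, Real.log (Real.tan x) =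
      ∫ x in (0 : ℝ)..π / 2, (Real.log (Real.sin x) - Real.log (Real.cos x)) :=
    integral_congr_Ioo_of_le (by positivity) fun x hx => by
      rw [Real.tan_eq_sin_div_cos, Real.log_div
        (Real.sin_pos_of_pos_of_lt_pi hx.1 (by linarith [hx.2])).ne'
        (Real.cos_pos_of_mem_Ioo ⟨by linarith [hx.1], hx.2⟩).ne']
  have reflection := integral_comp_sub_left (a := 0) (b := π / 2)
    (fun x => Real.log (Real.sin x)) (π / 2)
  simp only [Real.sin_pi_div_two_sub, sub_self, sub_zero] at reflection
  rw [split]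
  exact (integral_sub intervalIntegrable_log_sin intervalIntegrable_log_cos).trans
    (sub_eq_zero.2 reflection.symm)

theorem pairing_quarticWeightAdd_one : pairing quarticWeightAdd 1 = π / (2 * √2) := by
  have total := pairing_quarticWeightAdd_comp 1
  simp only [Pi.one_apply, integral_const, smul_eq_mul, sub_zero, mul_one] at total
  rw [← div_div, eq_div_iff (by positivity), mul_comm]
  exact total

theorem pairing_quarticWeightAdd_log_one_sub_sq :
    pairing quarticWeightAdd (fun y => Real.log (1 - y ^ 2)) =
      pairing quarticWeightAdd Real.log + π * Real.log 2 / (4 * √2) := by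
  have one_int : IntervalIntegrable (1 : ℝ → ℝ) volume 0 1 := intervalIntegrable_const
  have log_int : IntervalIntegrable Real.log volume 0 1 := intervalIntegrable_log'
  have weight := continuous_quarticWeightAdd.continuousOn (s := uIcc 0 1)
  have comp := pairing_quarticWeightAdd_comp fun x => Real.log (Real.tan x)
  have transformed : pairing quarticWeightAdd (fun y => Real.log (Real.tan (quarticArctan y))) =
      pairing quarticWeightAdd fun y =>
        Real.log y - Real.log (1 - y ^ 2) - -(Real.log 2 / 2) * (1 : ℝ → ℝ) y := by
    refine integral_congr_Ioo_of_le zero_le_one fun y hy => ?_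
    have hsub : 0 < 1 - y ^ 2 := by nlinarith [hy.1, hy.2]
    simp only [tan_quarticArctan (sub_pos.1 hsub), Pi.one_apply]
    rw [Real.log_div (mul_pos (by positivity) hy.1).ne' hsub.ne',
      Real.log_mul (by positivity) hy.1.ne', log_sqrt_two]
    ring
  rw [integral_log_tan_zero_pi_div_two, transformed, mul_eq_zero_iff_left (by positivity),
    pairing_sub weight (log_int.sub intervalIntegrable_log_one_sub_sq) (one_int.const_mul _),
    pairing_sub weight log_int intervalIntegrable_log_one_sub_sq, pairing_const_mul,
    pairing_quarticWeightAdd_one] at comp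
  linear_combination -comp

/-! ### The series -/

namespace HasSumFromOne

variable {f g : ℕ → ℝ} {s t : ℝ}

theorem congr (hf : HasSumFromOne f s) (h : ∀ k : ℕ, 0 < k → f k = g k) (hst : s = t) :
    HasSumFromOne g t :=
  hst ▸ HasSum.congr_fun hf fun n => (h (n + 1) n.succ_pos).symm

theorem add (hf : HasSumFromOne f s) (hg : HasSumFromOne g t) :
    HasSumFromOne (fun k => f k + g k) (s + t) :=
  HasSum.add hf hg

theorem sub (hf : HasSumFromOne f s) (hg : HasSumFromOne g t) :
    HasSumFromOne (fun k => f k - g k) (s - t) :=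
  HasSum.sub hf hg

theorem const_mul (hf : HasSumFromOne f s) (c : ℝ) : HasSumFromOne (fun k => c * f k) (c * s) :=
  HasSum.mul_left c hf

end HasSumFromOne

theorem hasSum_half_pow_mul_betaMoment_self {h : ℝ → ℝ} (hh : IntervalIntegrable h volume 0 1) :
    HasSum (fun n : ℕ => (1 / 2) ^ (n + 1) * betaMoment h n (2 * n + 2))
      ((pairing quadWeight h - pairing quarticWeightAdd h +
        3 * pairing quarticWeightSub h) / 5) := by
  have key := hasSum_half_pow_mul_betaMoment_partial_fractions hh (1 / 5) (-1 / 5) (3 / 5)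
  have value : 1 / 5 * pairing quadWeight h + -1 / 5 * pairing quarticWeightAdd h +
      3 / 5 * pairing quarticWeightSub h = (pairing quadWeight h - pairing quarticWeightAdd h +
        3 * pairing quarticWeightSub h) / 5 := by
    ring
  refine (value ▸ key).congr_fun fun n => ?_
  simp only [betaMoment]
  congr 2; ext y; ring

theorem hasSum_half_pow_mul_betaMoment_succ {h : ℝ → ℝ} (hh : IntervalIntegrable h volume 0 1) :
    HasSum (fun n : ℕ => 4 * (1 / 2) ^ (n + 1) * betaMoment h (n + 1) (2 * n + 1))
      (4 / 5 * (2 * pairing quarticWeightAdd h - 2 * pairing quadWeight h -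
        pairing quarticWeightSub h)) := by
  have key := hasSum_half_pow_mul_betaMoment_partial_fractions hh (-8 / 5) (8 / 5) (-4 / 5)
  have value : -8 / 5 * pairing quadWeight h + 8 / 5 * pairing quarticWeightAdd h +
      -4 / 5 * pairing quarticWeightSub h = 4 / 5 * (2 * pairing quarticWeightAdd h -
        2 * pairing quadWeight h - pairing quarticWeightSub h) := by
    ring
  refine (value ▸ key).congr_fun fun n => ?_
  simp only [betaMoment, mul_comm (4 : ℝ), mul_assoc, ← intervalIntegral.integral_const_mul]
  congr 2; ext y; ring

theorem hasSumFromOne_binomFactor_div_two_mul_sub_one_pairing :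
    HasSumFromOne (fun k => binomFactor k / (2 * (k : ℝ) - 1))
      ((pairing quadWeight 1 - pairing quarticWeightAdd 1 + 3 * pairing quarticWeightSub 1) / 5) :=
  (hasSum_half_pow_mul_betaMoment_self (h := 1) intervalIntegrable_const).congr_fun fun n => by
    beta_reduce
    rw [half_pow_mul_betaMoment_one]
    push_cast
    ring

theorem hasSumFromOne_oddHarmonic_mul_binomFactor_div_two_mul_sub_one_pairing :
    HasSumFromOne
      (fun k => (oddHarmonic k - oddHarmonic (3 * k) - 1 / (2 * (k : ℝ) - 1)) *
        (binomFactor k / (2 * (k : ℝ) - 1)))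
      ((pairing quadWeight Real.log - pairing quarticWeightAdd Real.log +
        3 * pairing quarticWeightSub Real.log) / 5) :=
  (hasSum_half_pow_mul_betaMoment_self intervalIntegrable_log').congr_fun fun n => by
    beta_reduce
    rw [betaMoment_log, mul_neg, ← mul_assoc, half_pow_mul_betaMoment_one,
      show n + (2 * n + 2) + 1 = 3 * (n + 1) by ring, oddHarmonic_succ n]
    push_cast
    ring

theorem hasSumFromOne_H_two_mul_mul_binomFactor_div_two_mul_sub_one_pairing :
    HasSumFromOne
      (fun k => (H (2 * k) + 2 * Real.log 2 - 2 * oddHarmonic (3 * k)) *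
        (binomFactor k / (2 * (k : ℝ) - 1)))
      ((pairing quadWeight (fun y => Real.log (1 - y ^ 2)) -
        pairing quarticWeightAdd (fun y => Real.log (1 - y ^ 2)) +
        3 * pairing quarticWeightSub (fun y => Real.log (1 - y ^ 2))) / 5) :=
  (hasSum_half_pow_mul_betaMoment_self intervalIntegrable_log_one_sub_sq).congr_fun fun n => by
    beta_reduce
    rw [betaMoment_log_one_sub_sq, ← mul_assoc, half_pow_mul_betaMoment_one,
      show n + (2 * n + 2) + 1 = 3 * (n + 1) by ring, show 2 * n + 2 = 2 * (n + 1) by ring]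
    push_cast
    ring

theorem hasSumFromOne_binomFactor_div_pairing :
    HasSumFromOne (fun k => binomFactor k / k)
      (4 / 5 * (2 * pairing quarticWeightAdd 1 - 2 * pairing quadWeight 1 -
        pairing quarticWeightSub 1)) :=
  (hasSum_half_pow_mul_betaMoment_succ (h := 1) intervalIntegrable_const).congr_fun fun n => by
    beta_reduce
    rw [half_pow_mul_betaMoment_one_succ, Nat.cast_succ]

theorem hasSumFromOne_oddHarmonic_mul_binomFactor_div_pairing :
    HasSumFromOne (fun k => (oddHarmonic k - oddHarmonic (3 * k)) * (binomFactor k / k))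
      (4 / 5 * (2 * pairing quarticWeightAdd Real.log - 2 * pairing quadWeight Real.log -
        pairing quarticWeightSub Real.log)) :=
  (hasSum_half_pow_mul_betaMoment_succ intervalIntegrable_log').congr_fun fun n => by
    beta_reduce
    rw [betaMoment_log, mul_neg, ← mul_assoc, half_pow_mul_betaMoment_one_succ,
      show n + 1 + (2 * n + 1) + 1 = 3 * (n + 1) by ring]
    push_cast
    ring

theorem hasSumFromOne_H_two_mul_sub_one_mul_binomFactor_div_pairing :
    HasSumFromOne
      (fun k => (H (2 * k - 1) + 2 * Real.log 2 - 2 * oddHarmonic (3 * k)) * (binomFactor k / k))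
      (4 / 5 * (2 * pairing quarticWeightAdd (fun y => Real.log (1 - y ^ 2)) -
        2 * pairing quadWeight (fun y => Real.log (1 - y ^ 2)) -
        pairing quarticWeightSub (fun y => Real.log (1 - y ^ 2)))) :=
  (hasSum_half_pow_mul_betaMoment_succ intervalIntegrable_log_one_sub_sq).congr_fun fun n => by
    beta_reduce
    rw [betaMoment_log_one_sub_sq, ← mul_assoc, half_pow_mul_betaMoment_one_succ,
      show n + 1 + (2 * n + 1) + 1 = 3 * (n + 1) by ring, show 2 * (n + 1) - 1 = 2 * n + 1 by lia]
    push_cast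
    ring

theorem hasSumFromOne_binomFactor_div_two_mul_sub_one_sq_pairing :
    HasSumFromOne (fun k => binomFactor k / (2 * (k : ℝ) - 1) ^ 2)
      (pairing quarticWeightAdd 1 / 2 - pairing quadWeight 1 +
        pairing quadWeight Real.log - pairing quarticWeightSub Real.log) := by
  have log_int : IntervalIntegrable Real.log volume 0 1 := intervalIntegrable_log'
  have sq_int : IntervalIntegrable (fun y : ℝ => y ^ 2 / 2) volume 0 1 :=
    Continuous.intervalIntegrable (by fun_prop) _ _
  have key := hasSum_half_pow_mul_betaMoment_partial_fractions (sq_int.sub log_int) (-1) 0 1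
  have value : -1 * pairing quadWeight (fun y => y ^ 2 / 2 - Real.log y) +
      0 * pairing quarticWeightAdd (fun y => y ^ 2 / 2 - Real.log y) +
      1 * pairing quarticWeightSub (fun y => y ^ 2 / 2 - Real.log y) =
      pairing quarticWeightAdd 1 / 2 - pairing quadWeight 1 +
        pairing quadWeight Real.log - pairing quarticWeightSub Real.log := by
    rw [pairing_sub continuousOn_quadWeight sq_int log_int,
      pairing_sub continuous_quarticWeightSub.continuousOn sq_int log_int,
      pairing_quadWeight_sq_half, pairing_quarticWeightSub_sq_half]
    ring
  refine (value ▸ key).congr_fun fun n => ?_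
  have weight : (fun y : ℝ => (-1 * (1 + y ^ 4) + (0 * (1 + y ^ 2) + 1 * (1 - y ^ 2)) *
      (2 - y ^ 2)) * (y ^ 2 / 2 - Real.log y)) =
      fun y => (1 - 3 * y ^ 2) * (y ^ 2 / 2 - Real.log y) := by
    ext y; ring
  have moment := half_pow_mul_betaMoment_one n
  rw [← betaMoment_mul_sq_half_sub_log, ← weight, eq_div_iff (by positivity)] at moment
  rw [div_eq_iff (by push_cast; ring_nf; positivity)]
  push_cast
  linear_combination -moment

theorem div_sqrt_two (x : ℝ) : x / √2 = x * √2 / 2 := by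
  rw [mul_div_assoc, Real.sqrt_div_self, div_eq_mul_inv]

theorem pairing_quadWeight_log_eq_reLi11 : pairing quadWeight Real.log =
    √2 / 2 * (2 * reLi11 - 3 * Real.log 2 ^ 2 / 16 + Real.log 2 * Real.log (1 + √2) / 4 -
      Real.log (1 + √2) ^ 2 / 4 - 11 * π ^ 2 / 192) := by
  have chi := reChi_sqrt_two_div_two
  rw [reDilog_half] at chi
  rw [pairing_quadWeight_log, div_sqrt_two]
  linear_combination -√2 / 4 * chi - √2 * reLi11_eq

theorem four_mul_pairing_quadWeight_log_add : 4 * pairing quadWeight Real.log +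
    pairing quadWeight (fun y => Real.log (1 - y ^ 2)) =
      √2 * Real.log 2 * Real.log (1 + √2) - √2 * π ^ 2 / 4 := by
  rw [pairing_quadWeight_log_eq_reLi11, pairing_quadWeight_log_one_sub_sq]
  linear_combination 4 * √2 * reLi11_eq

theorem two_mul_sub_one_ne_zero {k : ℕ} (hk : 0 < k) : 2 * (k : ℝ) - 1 ≠ 0 := by
  have : (1 : ℝ) ≤ k := Nat.one_le_cast.2 hk
  linarith

theorem oddHarmonic_three_mul (k : ℕ) : oddHarmonic (3 * k) = H (6 * k) - H (3 * k) / 2 := by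
  rw [oddHarmonic, ← mul_assoc]
  rfl

theorem hasSumFromOne_binomFactor_div_two_mul_sub_one :
    HasSumFromOne (fun k => binomFactor k / (2 * (k : ℝ) - 1))
      (2 * √2 * Real.log (1 + √2) / 5 - Real.pi / (10 * √2)) := by
  refine hasSumFromOne_binomFactor_div_two_mul_sub_one_pairing.congr (fun _ _ => rfl) ?_
  rw [pairing_quadWeight_one, pairing_quarticWeightAdd_one, pairing_quarticWeightSub_one]
  simp only [div_mul_eq_div_div, div_sqrt_two]
  ring

theorem hasSumFromOne_H_six_mul_mul_binomFactor_div_two_mul_sub_one :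
    HasSumFromOne
      (fun k => (-H k + 2 * H (2 * k) + H (3 * k) - 2 * H (6 * k) - 2 / (2 * (k : ℝ) - 1)) *
        binomFactor k / (2 * (k : ℝ) - 1))
      (2 * √2 * (reLi11 + imLi2 - catalanG / 4) / 5
        - 3 * Real.log 2 ^ 2 / (40 * √2)
        + Real.log 2 * Real.log (1 + √2) / (10 * √2)
        - Real.log (1 + √2) ^ 2 / (10 * √2)
        - 83 * Real.pi ^ 2 / (480 * √2)) := by
  have sq : √(2 : ℝ) ^ 2 = 2 := Real.sq_sqrt zero_le_two
  refine (hasSumFromOne_oddHarmonic_mul_binomFactor_div_two_mul_sub_one_pairing.const_mul 2).congr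
    (fun k _ => ?_) ?_
  · rw [oddHarmonic_three_mul, oddHarmonic]
    ring
  · rw [pairing_quadWeight_log_eq_reLi11, pairing_quarticWeightAdd_log,
      pairing_quarticWeightSub_log]
    simp only [div_mul_eq_div_div, div_sqrt_two]
    linear_combination -(2 * √2) / 5 * imLi2_sub_catalanG - LConst / 5 * sq

theorem hasSumFromOne_H_sub_H_two_mul_mul_binomFactor_div_two_mul_sub_one :
    HasSumFromOne
      (fun k => (H k - H (2 * k) + 2 / (2 * (k : ℝ) - 1) + 2 * Real.log 2) *
        binomFactor k / (2 * (k : ℝ) - 1))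
      (-(√2 * (15 * reLi11 + imLi2 - catalanG / 4) / 5)
        + 9 * Real.log 2 ^ 2 / (16 * √2)
        + 17 * Real.log 2 * Real.log (1 + √2) / (20 * √2)
        + 3 * Real.log (1 + √2) ^ 2 / (4 * √2)
        - Real.pi * Real.log 2 / (20 * √2)
        - Real.pi ^ 2 / (320 * √2)) := by
  have sq : √(2 : ℝ) ^ 2 = 2 := Real.sq_sqrt zero_le_two
  refine (hasSumFromOne_H_two_mul_mul_binomFactor_div_two_mul_sub_one_pairing.sub
    (hasSumFromOne_oddHarmonic_mul_binomFactor_div_two_mul_sub_one_pairing.const_mul 2)).congr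
    (fun k _ => ?_) ?_
  · rw [oddHarmonic_three_mul, oddHarmonic]
    ring
  · rw [pairing_quarticWeightSub_log_one_sub_sq, pairing_quarticWeightAdd_log_one_sub_sq,
      eq_sub_of_add_eq' four_mul_pairing_quadWeight_log_add, pairing_quadWeight_log_eq_reLi11,
      pairing_quarticWeightAdd_log, pairing_quarticWeightSub_log]
    simp only [div_mul_eq_div_div, div_sqrt_two]
    linear_combination √2 / 5 * imLi2_sub_catalanG + LConst / 10 * sq

theorem hasSumFromOne_binomFactor_div_two_mul_sub_one_sq :
    HasSumFromOne (fun k => binomFactor k / (2 * (k : ℝ) - 1) ^ 2)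
      (√2 * reLi11
        - 3 * Real.log 2 ^ 2 / (16 * √2)
        + Real.log 2 * Real.log (1 + √2) / (4 * √2)
        - Real.log (1 + √2) / √2
        - Real.log (1 + √2) ^ 2 / (4 * √2)
        + Real.pi / (4 * √2)
        + 13 * Real.pi ^ 2 / (192 * √2)) := by
  refine hasSumFromOne_binomFactor_div_two_mul_sub_one_sq_pairing.congr (fun _ _ => rfl) ?_
  rw [pairing_quadWeight_log_eq_reLi11, pairing_quarticWeightSub_log, pairing_quadWeight_one,
    pairing_quarticWeightAdd_one]
  simp only [div_mul_eq_div_div, div_sqrt_two]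
  ring

theorem hasSumFromOne_binomFactor_div_mul_pairing :
    HasSumFromOne (fun k => binomFactor k / ((k : ℝ) * (2 * (k : ℝ) - 1)))
      (2 * (pairing quadWeight 1 - pairing quarticWeightAdd 1 + pairing quarticWeightSub 1)) := by
  refine ((hasSumFromOne_binomFactor_div_two_mul_sub_one_pairing.const_mul 2).sub
    hasSumFromOne_binomFactor_div_pairing).congr (fun k hk => ?_) (by ring)
  have := two_mul_sub_one_ne_zero hk
  field_simp
  ring

theorem hasSumFromOne_mul_binomFactor_div_mul_pairing :
    HasSumFromOne (fun k => (5 * (k : ℝ) - 1) * binomFactor k / ((k : ℝ) * (2 * (k : ℝ) - 1)))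
      (pairing quarticWeightAdd 1 - pairing quadWeight 1 + pairing quarticWeightSub 1) := by
  refine ((hasSumFromOne_binomFactor_div_two_mul_sub_one_pairing.const_mul 3).add
    hasSumFromOne_binomFactor_div_pairing).congr (fun k hk => ?_) (by ring)
  have := two_mul_sub_one_ne_zero hk
  field_simp
  ring

theorem hasSumFromOne_oddHarmonic_mul_binomFactor_div_mul_pairing :
    HasSumFromOne
      (fun k => ((5 * (k : ℝ) - 1) * (oddHarmonic k - oddHarmonic (3 * k)) -
        3 * (k : ℝ) / (2 * (k : ℝ) - 1)) * binomFactor k / ((k : ℝ) * (2 * (k : ℝ) - 1)))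
      (pairing quarticWeightAdd Real.log - pairing quadWeight Real.log +
        pairing quarticWeightSub Real.log) := by
  refine ((hasSumFromOne_oddHarmonic_mul_binomFactor_div_two_mul_sub_one_pairing.const_mul 3).add
    hasSumFromOne_oddHarmonic_mul_binomFactor_div_pairing).congr (fun k hk => ?_) (by ring)
  have := two_mul_sub_one_ne_zero hk
  field_simp
  ring

theorem hasSumFromOne_H_two_mul_mul_binomFactor_div_mul_pairing :
    HasSumFromOne
      (fun k => ((5 * (k : ℝ) - 1) * (H (2 * k) + 2 * Real.log 2 - 2 * oddHarmonic (3 * k)) -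
        (2 * (k : ℝ) - 1) / (2 * k)) * binomFactor k / ((k : ℝ) * (2 * (k : ℝ) - 1)))
      (pairing quarticWeightAdd (fun y => Real.log (1 - y ^ 2)) -
        pairing quadWeight (fun y => Real.log (1 - y ^ 2)) +
        pairing quarticWeightSub (fun y => Real.log (1 - y ^ 2))) := by
  refine ((hasSumFromOne_H_two_mul_mul_binomFactor_div_two_mul_sub_one_pairing.const_mul 3).add
    hasSumFromOne_H_two_mul_sub_one_mul_binomFactor_div_pairing).congr (fun k hk => ?_) (by ring)
  have := two_mul_sub_one_ne_zero hk
  rw [H_sub_one (by lia : 0 < 2 * k)]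
  push_cast
  field_simp
  ring

theorem hasSumFromOne_H_two_mul_sub_one_mul_binomFactor_div_mul :
    HasSumFromOne
      (fun k => ((5 * (k : ℝ) - 1) * (H (2 * k - 1) - H (k - 1))
          - 3 * (6 * (k : ℝ) - 1) / (4 * (2 * (k : ℝ) - 1))) *
        binomFactor k / ((k : ℝ) * (2 * (k : ℝ) - 1)))
      (3 * √2 * Real.pi * Real.log 2 / 8 - LConst) := by
  refine ((((hasSumFromOne_oddHarmonic_mul_binomFactor_div_mul_pairing.const_mul 2).sub
    hasSumFromOne_H_two_mul_mul_binomFactor_div_mul_pairing).add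
    (hasSumFromOne_mul_binomFactor_div_mul_pairing.const_mul (2 * Real.log 2))).add
    ((hasSumFromOne_binomFactor_div_mul_pairing.const_mul (3 / 4)).add
    (hasSumFromOne_binomFactor_div_two_mul_sub_one_sq_pairing.const_mul 3))).congr
    (fun k hk => ?_) ?_
  · have := two_mul_sub_one_ne_zero hk
    rw [H_sub_one hk, H_sub_one (by lia : 0 < 2 * k), oddHarmonic]
    push_cast
    field_simp
    ring
  · rw [pairing_quarticWeightSub_log_one_sub_sq, pairing_quarticWeightAdd_log_one_sub_sq,
      eq_sub_of_add_eq' four_mul_pairing_quadWeight_log_add, pairing_quarticWeightAdd_log,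
      pairing_quarticWeightSub_log, pairing_quadWeight_one, pairing_quarticWeightAdd_one,
      pairing_quarticWeightSub_one]
    simp only [div_mul_eq_div_div, div_sqrt_two]
    ring

theorem hasSumFromOne_H_six_mul_sub_one_mul_binomFactor_div_mul :
    HasSumFromOne
      (fun k => ((5 * (k : ℝ) - 1) * (2 * H (6 * k - 1) - H (3 * k - 1) - H (k - 1))
          - 2 * (3 * (k : ℝ) - 1) / (2 * (k : ℝ) - 1)) *
        binomFactor k / ((k : ℝ) * (2 * (k : ℝ) - 1)))
      (3 * √2 * Real.pi * Real.log 2 / 4) := by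
  refine ((((hasSumFromOne_oddHarmonic_mul_binomFactor_div_mul_pairing.sub
    hasSumFromOne_H_two_mul_mul_binomFactor_div_mul_pairing).const_mul 2).add
    (hasSumFromOne_mul_binomFactor_div_mul_pairing.const_mul (4 * Real.log 2))).add
    (hasSumFromOne_binomFactor_div_mul_pairing.add
    (hasSumFromOne_binomFactor_div_two_mul_sub_one_sq_pairing.const_mul 4))).congr
    (fun k hk => ?_) ?_
  · have := two_mul_sub_one_ne_zero hk
    rw [H_sub_one hk, H_sub_one (by lia : 0 < 3 * k), H_sub_one (by lia : 0 < 6 * k),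
      oddHarmonic_three_mul, oddHarmonic]
    push_cast
    field_simp
    ring
  · rw [pairing_quarticWeightSub_log_one_sub_sq, pairing_quarticWeightAdd_log_one_sub_sq,
      eq_sub_of_add_eq' four_mul_pairing_quadWeight_log_add, pairing_quarticWeightAdd_log,
      pairing_quarticWeightSub_log, pairing_quadWeight_one, pairing_quarticWeightAdd_one,
      pairing_quarticWeightSub_one]
    simp only [div_mul_eq_div_div, div_sqrt_two]
    ring

theorem mainTheorem3 :
    HasSumFromOne (fun k => binomFactor k / (2 * (k : ℝ) - 1))
      (2 * √2 * Real.log (1 + √2) / 5 - Real.pi / (10 * √2)) ∧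
    HasSumFromOne
      (fun k => (-H k + 2 * H (2 * k) + H (3 * k) - 2 * H (6 * k) - 2 / (2 * (k : ℝ) - 1)) *
        binomFactor k / (2 * (k : ℝ) - 1))
      (2 * √2 * (reLi11 + imLi2 - catalanG / 4) / 5
        - 3 * Real.log 2 ^ 2 / (40 * √2)
        + Real.log 2 * Real.log (1 + √2) / (10 * √2)
        - Real.log (1 + √2) ^ 2 / (10 * √2)
        - 83 * Real.pi ^ 2 / (480 * √2)) ∧
    HasSumFromOne
      (fun k => (H k - H (2 * k) + 2 / (2 * (k : ℝ) - 1) + 2 * Real.log 2) *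
        binomFactor k / (2 * (k : ℝ) - 1))
      (-(√2 * (15 * reLi11 + imLi2 - catalanG / 4) / 5)
        + 9 * Real.log 2 ^ 2 / (16 * √2)
        + 17 * Real.log 2 * Real.log (1 + √2) / (20 * √2)
        + 3 * Real.log (1 + √2) ^ 2 / (4 * √2)
        - Real.pi * Real.log 2 / (20 * √2)
        - Real.pi ^ 2 / (320 * √2)) ∧
    HasSumFromOne (fun k => binomFactor k / (2 * (k : ℝ) - 1) ^ 2)
      (√2 * reLi11
        - 3 * Real.log 2 ^ 2 / (16 * √2)
        + Real.log 2 * Real.log (1 + √2) / (4 * √2)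
        - Real.log (1 + √2) / √2
        - Real.log (1 + √2) ^ 2 / (4 * √2)
        + Real.pi / (4 * √2)
        + 13 * Real.pi ^ 2 / (192 * √2)) ∧
    HasSumFromOne
      (fun k => ((5 * (k : ℝ) - 1) * (H (2 * k - 1) - H (k - 1))
          - 3 * (6 * (k : ℝ) - 1) / (4 * (2 * (k : ℝ) - 1))) *
        binomFactor k / ((k : ℝ) * (2 * (k : ℝ) - 1)))
      (3 * √2 * Real.pi * Real.log 2 / 8 - LConst) ∧
    HasSumFromOne
      (fun k => ((5 * (k : ℝ) - 1) * (2 * H (6 * k - 1) - H (3 * k - 1) - H (k - 1))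
          - 2 * (3 * (k : ℝ) - 1) / (2 * (k : ℝ) - 1)) *
        binomFactor k / ((k : ℝ) * (2 * (k : ℝ) - 1)))
      (3 * √2 * Real.pi * Real.log 2 / 4) ∧
    HasSumFromOne
      (fun k => ((5 * (k : ℝ) - 1) *
          (12 * H (6 * k - 1) - 6 * H (3 * k - 1) - 4 * H (2 * k - 1) - 2 * H (k - 1)) - 9) *
        binomFactor k / ((k : ℝ) * (2 * (k : ℝ) - 1)))
      (3 * √2 * Real.pi * Real.log 2 + 4 * LConst) := by
  refine ⟨hasSumFromOne_binomFactor_div_two_mul_sub_one,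
    hasSumFromOne_H_six_mul_mul_binomFactor_div_two_mul_sub_one,
    hasSumFromOne_H_sub_H_two_mul_mul_binomFactor_div_two_mul_sub_one,
    hasSumFromOne_binomFactor_div_two_mul_sub_one_sq,
    hasSumFromOne_H_two_mul_sub_one_mul_binomFactor_div_mul,
    hasSumFromOne_H_six_mul_sub_one_mul_binomFactor_div_mul, ?_⟩
  refine ((hasSumFromOne_H_six_mul_sub_one_mul_binomFactor_div_mul.const_mul 6).sub
    (hasSumFromOne_H_two_mul_sub_one_mul_binomFactor_div_mul.const_mul 4)).congr
    (fun k hk => ?_) (by ring)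
  have rational : 4 * (3 * (6 * (k : ℝ) - 1) / (4 * (2 * k - 1))) -
      6 * (2 * (3 * k - 1) / (2 * k - 1)) = -9 := by
    grind [two_mul_sub_one_ne_zero hk]
  linear_combination binomFactor k / (k * (2 * k - 1)) * rational
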